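/- Let $n\in\mathbb{N}$. For a nonempty polytope $P\subset\mathbb{R}^n$ (the convex hull of a nonempty finite set) and $\alpha\in\mathbb{R}^n$ (identified with $(\mathbb{R}^n)^*$ by the standard inner product) let $F_\alpha(P)=\{p\in P : \langle\alpha,p-x\rangle\ge 0\ \forall x\in P\}$; these sets are the faces of $P$. The normal cone of a face $F$ is $N(P,F)=\{\alpha : F\subseteq F_\alpha(P)\}$, and the normal fan $\mathcal{N}(P)$ is the collection of the normal cones of all faces of $P$. A fan $\Sigma'$ refines a fan $\Sigma$ if every cone of $\Sigma'$ is contained in some cone of $\Sigma$. A Delzant polytope is a full-dimensional polytope $P\subset\mathbb{R}^n$ whose normal fan is unimodular, i.e. every cone $C\in\mathcal{N}(P)$ is generated by linearly independent integer vectors that form a $\mathbb{Z}$-basis of the lattice $\mathbb{R}C\cap\mathbb{Z}^n$. Let $\mathcal{D}(n)$ be the space of all Delzant polytopes in $\mathbb{R}^n$, with the topology induced by the Hausdorff distance. A path $\gamma:[0,1]\to\mathcal{D}(n)$ is locally refining if for every $t_0\in[0,1]$ there is an $\varepsilon>0$ such that $\mathcal{N}(\gamma(t))$ refines $\mathcal{N}(\gamma(t_0))$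 for every $t\in[0,1]$ with $|t-t_0|\le\varepsilon$. It has finite complexity if only finitely many distinct normal fans occur among the polytopes $\gamma(t)$, $t\in[0,1]$. **Theorem.** Every locally refining loop $\gamma$ in $\mathcal{D}(n)$ is null-homotopic (homotopic, relative to its endpoints, to the constant loop at its base point). Moreover, every loop of finite complexity in $\mathcal{D}(n)$ is locally refining; in particular, loops of finite complexity are null-homotopic. -/

import Mathlib

open scoped unitInterval
open TopologicalSpace

/-- `ℝⁿ` with its Euclidean norm. The dual space is identified with `ℝⁿ` through the standard
inner product, so that normal cones and normal fans live in `ℝⁿ` too. -/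
abbrev EucSp (n : ℕ) : Type := EuclideanSpace ℝ (Fin n)

/-- A convex polytope: the convex hull of a finite nonempty set of points. -/
def IsPolytope {n : ℕ} (P : Set (EucSp n)) : Prop :=
  ∃ S : Finset (EucSp n), S.Nonempty ∧ P = convexHull ℝ (S : Set (EucSp n))

/-- The face `F_α(P) = {p ∈ P | ⟨α, p - x⟩ ≥ 0 for all x ∈ P}` of `P` in the direction `α`. -/
def faceDir {n : ℕ} (P : Set (EucSp n)) (α : EucSp n) : Set (EucSp n) :=
  {p | p ∈ P ∧ ∀ x ∈ P, 0 ≤ inner ℝ α (p - x)}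

/-- `F` is a face of `P`: it is the face of `P` in some direction (possibly `0`, giving `P`). -/
def IsFaceOf {n : ℕ} (P F : Set (EucSp n)) : Prop :=
  ∃ α : EucSp n, F = faceDir P α

/-- The normal cone `N(P, F) = {α | F ⊆ F_α(P)}`. -/
def normalConeAt {n : ℕ} (P F : Set (EucSp n)) : Set (EucSp n) :=
  {α | F ⊆ faceDir P α}

/-- The normal fan of `P`: the collection of the normal cones of all its faces. -/
def normalFan {n : ℕ} (P : Set (EucSp n)) : Set (Set (EucSp n)) :=
  {C | ∃ F : Set (EucSp n), IsFaceOf P F ∧ C = normalConeAt P F}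

/-- The fan `S'` refines the fan `S`: every cone of `S'` is contained in some cone of `S`. -/
def FanRefines {n : ℕ} (S' S : Set (Set (EucSp n))) : Prop :=
  ∀ C' ∈ S', ∃ C ∈ S, C' ⊆ C

/-- The integer vector `z ∈ ℤⁿ`, as a point of `ℝⁿ`. -/
def intVec {n : ℕ} (z : Fin n → ℤ) : EucSp n :=
  WithLp.toLp 2 (fun i => (z i : ℝ))

/-- A rational simplicial cone of multiplicity one: it is generated by linearly independent
integer vectors `v₁, …, vₘ` which generate the whole lattice `ℝC ∩ ℤⁿ` of integer points of its
linear span. (Such `vᵢ` are automatically primitive, being part of a lattice basis.) -/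
def IsUnimodularCone {n : ℕ} (C : Set (EucSp n)) : Prop :=
  ∃ (m : ℕ) (v : Fin m → Fin n → ℤ),
    LinearIndependent ℝ (fun i => intVec (v i)) ∧
    C = (PointedCone.hull ℝ (Set.range fun i => intVec (v i)) : Set (EucSp n)) ∧
    ∀ z : Fin n → ℤ, intVec z ∈ Submodule.span ℝ C →
      z ∈ Submodule.span ℤ (Set.range v)

/-- A Delzant polytope: a full-dimensional polytope whose normal fan is unimodular, that is,
all of its cones are rational, simplicial and of multiplicity one. (The normal fan of a polytope
is complete, so it is automatically a full-dimensional fan.) -/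
structure IsDelzant {n : ℕ} (P : Set (EucSp n)) : Prop where
  isPolytope : IsPolytope P
  fullDim : affineSpan ℝ P = ⊤
  unimodular : ∀ C ∈ normalFan P, IsUnimodularCone C

/-- The space `𝒟(n)` of Delzant `n`-polytopes. Its topology is the one induced by the Hausdorff
distance, which is Mathlib's metric on `NonemptyCompacts`. -/
abbrev DelzantSpace (n : ℕ) : Type :=
  {K : NonemptyCompacts (EucSp n) // IsDelzant (K : Set (EucSp n))}

/-- The normal fan of a point of `𝒟(n)`. -/
def DelzantSpace.fan {n : ℕ} (P : DelzantSpace n) : Set (Set (EucSp n)) :=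
  normalFan ((P : NonemptyCompacts (EucSp n)) : Set (EucSp n))

/-- A path `γ` in `𝒟(n)` is locally refining if for every `t₀ ∈ [0,1]` there is an `ε > 0` such
that the fan of `γ(t)` refines that of `γ(t₀)` whenever `|t - t₀| ≤ ε`. -/
def IsLocallyRefining {n : ℕ} {P Q : DelzantSpace n} (γ : Path P Q) : Prop :=
  ∀ t₀ : I, ∃ ε : ℝ, 0 < ε ∧
    ∀ t : I, |(t : ℝ) - (t₀ : ℝ)| ≤ ε → FanRefines (γ t).fan (γ t₀).fan

/-- A path in `𝒟(n)` has finite complexity if only finitely many normal fans arise along it. -/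
def HasFiniteComplexity {n : ℕ} {P Q : DelzantSpace n} (γ : Path P Q) : Prop :=
  (Set.range fun t : I => (γ t).fan).Finite

/-! Refinement is tested on directions: `DirRefines Q P` asks that directions with a common
maximizer on Q have one on P. For polytopes this amounts to refinement of normal fans
(`FanRefines.dirRefines`, `DirRefines.fanRefines`). If Q is Delzant and refines the polytope P, then
aP + bQ with a ≥ 0, b > 0 has the normal cones of Q, hence is Delzant (`IsDelzant.minkComb`). So a
Delzant polytope and a Delzant refinement of it are joined by a straight path of Minkowski
combinations.

For a locally refining loop γ, compactness yields 0 = t₀ ≤ … ≤ t_N = 1 and centres τ_k such that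
γ(t) refines γ(τ_k) on [t_k, t_{k+1}]. Coning a piece to γ(τ_k) replaces it by two straight paths.
Let R be a Delzant polytope refining all γ(t_k) and γ(τ_k). Coning those straight paths to R turns
the piece into the straight path γ(t_k) → R followed by the reverse of γ(t_{k+1}) → R
(`DelzantSpace.mk_subpath_eq`). These products telescope, and around a loop everything cancels.

The existence of R (`exists_isDelzant_dirRefines`) is the combinatorial core. The normal cones of
the given polytopes are cut out by finitely many integer vectors m. Starting from a cube, faces of
codimension two are chopped off, which preserves smoothness, until no m is positive on one and
negative on another of the normals tight at a common point. Then each normal cone of the result lies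
in a normal cone of every given polytope.

For finite complexity: being refined by a fixed polytope survives Hausdorff limits
(`dirRefines_of_forall_near`), so a fan occurring arbitrarily close to t₀ refines the fan at t₀. The
remaining fans, finite in number, avoid a neighbourhood of t₀. -/

variable {n : ℕ}

/-! ### Faces and normal cones of polytopes -/

theorem mem_faceDir_iff {P : Set (EucSp n)} {α p : EucSp n} :
    p ∈ faceDir P α ↔ p ∈ P ∧ ∀ x ∈ P, inner ℝ α x ≤ inner ℝ α p := by
  simp [faceDir, inner_sub_right]

theorem faceDir_nonempty {P : Set (EucSp n)} (hP : IsCompact P) (hne : P.Nonempty)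
    (α : EucSp n) : (faceDir P α).Nonempty := by
  have hc : Continuous fun x : EucSp n => (inner ℝ α x : ℝ) := by fun_prop
  obtain ⟨p, hp, h⟩ := hP.exists_isMaxOn hne hc.continuousOn
  exact ⟨p, mem_faceDir_iff.2 ⟨hp, fun x hx => h hx⟩⟩

theorem IsPolytope.isCompact {P : Set (EucSp n)} (hP : IsPolytope P) : IsCompact P := by
  obtain ⟨S, -, rfl⟩ := hP
  exact S.finite_toSet.isCompact_convexHull ℝ

theorem IsPolytope.nonempty {P : Set (EucSp n)} (hP : IsPolytope P) : P.Nonempty := by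
  obtain ⟨S, hS, rfl⟩ := hP
  exact (S.coe_nonempty.2 hS).convexHull

theorem IsPolytope.faceDir_nonempty {P : Set (EucSp n)} (hP : IsPolytope P) (α : EucSp n) :
    (faceDir P α).Nonempty :=
  _root_.faceDir_nonempty hP.isCompact hP.nonempty α

/-- Directions with a common maximizer: the face of the sum is the intersection of the faces. -/
theorem faceDir_add_subset {P : Set (EucSp n)} {β δ : EucSp n}
    (h : (faceDir P β ∩ faceDir P δ).Nonempty) :
    faceDir P (β + δ) ⊆ faceDir P β ∩ faceDir P δ := by
  obtain ⟨q, h1, h2⟩ := h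
  rw [mem_faceDir_iff] at h1 h2
  intro x hx
  rw [mem_faceDir_iff] at hx
  have e := hx.2 q h1.1
  have e1 := h1.2 x hx.1
  have e2 := h2.2 x hx.1
  simp only [inner_add_left] at e
  exact ⟨mem_faceDir_iff.2 ⟨hx.1, fun y hy => by linarith [h1.2 y hy]⟩,
    mem_faceDir_iff.2 ⟨hx.1, fun y hy => by linarith [h2.2 y hy]⟩⟩

/-- A linear functional bounded on `S` is bounded on its convex hull. -/
theorem inner_le_of_mem_convexHull {S : Set (EucSp n)} {α x : EucSp n} {c : ℝ}
    (h : ∀ s ∈ S, inner ℝ α s ≤ c) (hx : x ∈ convexHull ℝ S) : inner ℝ α x ≤ c := by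
  have : convexHull ℝ S ⊆ {y | inner ℝ α y ≤ c} :=
    convexHull_min h (convex_halfSpace_le (innerₗ (EucSp n) α).isLinear c)
  exact this hx

theorem exists_mem_inter_faceDir_convexHull {S : Finset (EucSp n)} (hS : S.Nonempty)
    (α : EucSp n) : ∃ s ∈ S, s ∈ faceDir (convexHull ℝ (S : Set (EucSp n))) α := by
  obtain ⟨s, hs, h⟩ := S.exists_max_image (fun x => inner ℝ α x) hS
  exact ⟨s, hs, mem_faceDir_iff.2
    ⟨subset_convexHull _ _ hs, fun x hx => inner_le_of_mem_convexHull h hx⟩⟩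

/-- If every generator maximizing `α` maximizes `β`, then the defect of `β` is controlled by the
defect of `α`. -/
theorem exists_defect_le {S : Finset (EucSp n)} {α β : EucSp n} {p : EucSp n}
    (hα : p ∈ faceDir (convexHull ℝ (S : Set (EucSp n))) α)
    (hβ : p ∈ faceDir (convexHull ℝ (S : Set (EucSp n))) β)
    (h : ∀ s ∈ S, s ∈ faceDir (convexHull ℝ (S : Set (EucSp n))) α →
      s ∈ faceDir (convexHull ℝ (S : Set (EucSp n))) β) :
    ∃ N : ℝ, 0 < N ∧ ∀ x ∈ convexHull ℝ (S : Set (EucSp n)),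
      inner ℝ β p - inner ℝ β x ≤ N * (inner ℝ α p - inner ℝ α x) := by
  have key : ∀ s ∈ S, ∀ᶠ N : ℝ in Filter.atTop,
      inner ℝ β p - inner ℝ β s ≤ N * (inner ℝ α p - inner ℝ α s) := by
    intro s hs
    have hsP := subset_convexHull ℝ (S : Set (EucSp n)) hs
    rw [mem_faceDir_iff] at hα hβ
    -- With zero α-defect the β-defect vanishes as well and any N works; otherwise N need only
    -- exceed the ratio of the defects.
    rcases (hα.2 s hsP).eq_or_lt with e | e
    · have h1 := h s hs (mem_faceDir_iff.2 ⟨hsP, fun x hx => e ▸ hα.2 x hx⟩)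
      have h2 := (mem_faceDir_iff.1 h1).2 p hβ.1
      filter_upwards with N
      rw [e]; simp; linarith
    · filter_upwards [Filter.eventually_ge_atTop
        ((inner ℝ β p - inner ℝ β s) / (inner ℝ α p - inner ℝ α s))] with N hN
      rwa [div_le_iff₀ (by linarith)] at hN
  obtain ⟨N, hN, hN0⟩ := (((Filter.eventually_all_finset S).2 key).and
    (Filter.eventually_gt_atTop 0)).exists
  refine ⟨N, hN0, fun x hx => ?_⟩
  have := inner_le_of_mem_convexHull (α := N • α - β) (c := N * inner ℝ α p - inner ℝ β p)
    (fun s hs => by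
      simp only [inner_sub_left, inner_smul_left, RCLike.conj_to_real]
      linarith [hN s hs]) hx
  simp only [inner_sub_left, inner_smul_left, RCLike.conj_to_real] at this
  linarith

theorem faceDir_subset_of_generators {S : Finset (EucSp n)} (hS : S.Nonempty) {α β : EucSp n}
    (h : ∀ s ∈ S, s ∈ faceDir (convexHull ℝ (S : Set (EucSp n))) α →
      s ∈ faceDir (convexHull ℝ (S : Set (EucSp n))) β) :
    faceDir (convexHull ℝ (S : Set (EucSp n))) α ⊆
      faceDir (convexHull ℝ (S : Set (EucSp n))) β := by
  obtain ⟨p, hp, hpα⟩ := exists_mem_inter_faceDir_convexHull hS α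
  have hpβ := h p hp hpα
  obtain ⟨N, hN, hd⟩ := exists_defect_le hpα hpβ h
  intro x hx
  rw [mem_faceDir_iff] at hx hpα hpβ ⊢
  have h1 := hd x hx.1
  have h2 : inner ℝ α p - inner ℝ α x = 0 := le_antisymm
    (by linarith [hx.2 p hpα.1]) (by linarith [hpα.2 x hx.1])
  rw [h2] at h1
  exact ⟨hx.1, fun y hy => by linarith [hpβ.2 y hy]⟩

/-- A normal cone depends only on the generators lying in the face, so there are finitely many of
them. -/
theorem normalConeAt_eq_of_generators {S : Finset (EucSp n)} (hS : S.Nonempty) (α : EucSp n) :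
    normalConeAt (convexHull ℝ (S : Set (EucSp n)))
        (faceDir (convexHull ℝ (S : Set (EucSp n))) α) =
      normalConeAt (convexHull ℝ (S : Set (EucSp n)))
        (S ∩ faceDir (convexHull ℝ (S : Set (EucSp n))) α) := by
  ext β
  exact ⟨fun h s hs => h hs.2, fun h => faceDir_subset_of_generators hS fun s h1 h2 => h ⟨h1, h2⟩⟩

theorem IsPolytope.finite_normalFan {P : Set (EucSp n)} (hP : IsPolytope P) :
    (normalFan P).Finite := by
  obtain ⟨S, hS, rfl⟩ := hP
  refine (S.finite_toSet.finite_subsets.image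
    (normalConeAt (convexHull ℝ (S : Set (EucSp n))))).subset ?_
  rintro C ⟨F, ⟨α, rfl⟩, rfl⟩
  exact ⟨_, Set.inter_subset_left, (normalConeAt_eq_of_generators hS α).symm⟩

/-! ### Refinement in terms of common maximizers -/

/-- `Q` refines `P` on the level of directions: two directions with a common maximizer on `Q` have
a common maximizer on `P`. -/
def DirRefines (Q P : Set (EucSp n)) : Prop :=
  ∀ β δ : EucSp n, (faceDir Q β ∩ faceDir Q δ).Nonempty → (faceDir P β ∩ faceDir P δ).Nonempty

/-- By the defect bound, β and Nα - β share a maximizer on Q for some N > 0, hence share one on P.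
There Nα is the sum of two simultaneously maximized functionals, so each maximizer of α maximizes
both. -/
theorem DirRefines.faceDir_subset {P Q : Set (EucSp n)} (hQ : IsPolytope Q)
    (h : DirRefines Q P) {α β : EucSp n} (hαβ : faceDir Q α ⊆ faceDir Q β) :
    faceDir P α ⊆ faceDir P β := by
  obtain ⟨q, hq⟩ := hQ.faceDir_nonempty α
  obtain ⟨S, hS, rfl⟩ := hQ
  have hqβ := hαβ hq
  obtain ⟨N, hN, hd⟩ := exists_defect_le hq hqβ fun s _ hs => hαβ hs
  obtain ⟨p, hp1, hp2⟩ := h β (N • α - β) ⟨q, hqβ, mem_faceDir_iff.2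
    ⟨hq.1, fun x hx => by
      simp only [inner_sub_left, inner_smul_left, RCLike.conj_to_real]
      linarith [hd x hx]⟩⟩
  intro x hx
  rw [mem_faceDir_iff] at hp1 hp2 hx ⊢
  refine ⟨hx.1, fun y hy => ?_⟩
  have h1 := hp2.2 x hx.1
  simp only [inner_sub_left, inner_smul_left, RCLike.conj_to_real] at h1
  have h2 := mul_le_mul_of_nonneg_left (hx.2 p hp1.1) hN.le
  linarith [hp1.2 y hy]

theorem DirRefines.fanRefines {P Q : Set (EucSp n)} (hQ : IsPolytope Q)
    (h : DirRefines Q P) : FanRefines (normalFan Q) (normalFan P) := by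
  rintro C ⟨F, ⟨α, rfl⟩, rfl⟩
  exact ⟨_, ⟨_, ⟨α, rfl⟩, rfl⟩, fun β hβ => h.faceDir_subset hQ hβ⟩

/-- The normal cone of the face of Q in direction β + δ contains both β and δ, so some cone of P
contains both. -/
theorem FanRefines.dirRefines {P Q : Set (EucSp n)} (hP : IsPolytope P)
    (h : FanRefines (normalFan Q) (normalFan P)) : DirRefines Q P := by
  intro β δ hne
  obtain ⟨C, ⟨F, ⟨α, rfl⟩, rfl⟩, hC⟩ := h _ ⟨_, ⟨β + δ, rfl⟩, rfl⟩
  obtain ⟨p, hp⟩ := hP.faceDir_nonempty α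
  have hs := faceDir_add_subset hne
  exact ⟨p, hC (fun x hx => (hs hx).1) hp, hC (fun x hx => (hs hx).2) hp⟩

theorem fanRefines_refl (S : Set (Set (EucSp n))) : FanRefines S S :=
  fun C hC => ⟨C, hC, subset_rfl⟩

/-! ### Minkowski combinations -/

/-- The Minkowski combination `aP + bQ`. -/
def minkComb (a b : ℝ) (P Q : Set (EucSp n)) : Set (EucSp n) :=
  {z | ∃ p ∈ P, ∃ q ∈ Q, a • p + b • q = z}

theorem combination_mem_faceDir {a b : ℝ} (ha : 0 ≤ a) (hb : 0 ≤ b) {P Q : Set (EucSp n)}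
    {α p q : EucSp n} (hp : p ∈ faceDir P α) (hq : q ∈ faceDir Q α) :
    a • p + b • q ∈ faceDir (minkComb a b P Q) α := by
  rw [mem_faceDir_iff] at *
  refine ⟨⟨p, hp.1, q, hq.1, rfl⟩, ?_⟩
  rintro _ ⟨x, hx, y, hy, rfl⟩
  simp only [inner_add_right, inner_smul_right]
  have := mul_le_mul_of_nonneg_left (hp.2 x hx) ha
  have := mul_le_mul_of_nonneg_left (hq.2 y hy) hb
  linarith

theorem mem_faceDir_of_combination {a b : ℝ} (hb : 0 < b) {P Q : Set (EucSp n)}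
    {α p q : EucSp n} (hp : p ∈ P) (hq : q ∈ Q)
    (h : a • p + b • q ∈ faceDir (minkComb a b P Q) α) : q ∈ faceDir Q α := by
  rw [mem_faceDir_iff] at *
  refine ⟨hq, fun y hy => ?_⟩
  have := h.2 _ ⟨p, hp, y, hy, rfl⟩
  simp only [inner_add_right, inner_smul_right] at this
  exact le_of_mul_le_mul_left (by linarith) hb

theorem minkComb_comm (a b : ℝ) (P Q : Set (EucSp n)) : minkComb a b P Q = minkComb b a Q P := by
  ext z
  constructor <;> rintro ⟨p, hp, q, hq, rfl⟩ <;> exact ⟨q, hq, p, hp, add_comm _ _⟩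

theorem DirRefines.minkComb {R P Q : Set (EucSp n)} (hP : DirRefines R P) (hQ : DirRefines R Q)
    {a b : ℝ} (ha : 0 ≤ a) (hb : 0 ≤ b) : DirRefines R (minkComb a b P Q) := by
  intro β δ h
  obtain ⟨p, hp1, hp2⟩ := hP β δ h
  obtain ⟨q, hq1, hq2⟩ := hQ β δ h
  exact ⟨_, combination_mem_faceDir ha hb hp1 hq1, combination_mem_faceDir ha hb hp2 hq2⟩

theorem IsPolytope.minkComb {P Q : Set (EucSp n)} (hP : IsPolytope P) (hQ : IsPolytope Q)
    (a b : ℝ) : IsPolytope (minkComb a b P Q) := by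
  classical
  obtain ⟨S, hS, rfl⟩ := hP
  obtain ⟨T, hT, rfl⟩ := hQ
  refine ⟨(S ×ˢ T).image fun z => a • z.1 + b • z.2, (hS.product hT).image _, ?_⟩
  have hlin := (a • LinearMap.fst ℝ (EucSp n) (EucSp n) + b • LinearMap.snd ℝ _ _).image_convexHull
    ((S : Set (EucSp n)) ×ˢ (T : Set (EucSp n)))
  rw [convexHull_prod] at hlin
  rw [Finset.coe_image, Finset.coe_product]
  refine Eq.trans ?_ hlin
  ext z
  constructor
  · rintro ⟨p, hp, q, hq, rfl⟩
    exact ⟨(p, q), ⟨hp, hq⟩, rfl⟩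
  · rintro ⟨⟨p, q⟩, ⟨hp, hq⟩, rfl⟩
    exact ⟨p, hp, q, hq, rfl⟩

theorem affineSpan_minkComb {P Q : Set (EucSp n)} (hP : P.Nonempty)
    (hQ : affineSpan ℝ Q = ⊤) (a : ℝ) {b : ℝ} (hb : b ≠ 0) :
    affineSpan ℝ (minkComb a b P Q) = ⊤ := by
  obtain ⟨p, hp⟩ := hP
  let e : EucSp n ≃ᵃ[ℝ] EucSp n := (LinearEquiv.smulOfUnit (Units.mk0 b hb)).toAffineEquiv.trans
    (AffineEquiv.constVAdd ℝ (EucSp n) (a • p))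
  have h1 : e '' Q ⊆ minkComb a b P Q := by
    rintro _ ⟨q, hq, rfl⟩
    exact ⟨p, hp, q, hq, rfl⟩
  have h2 := (e.span_eq_top_iff (s := Q)).1 hQ
  exact top_le_iff.1 (h2 ▸ affineSpan_mono ℝ h1)

/-- The faces of a sum are sums of faces; since Q refines P, the summand P adds no condition, and
each normal cone is that of Q in the same direction. -/
theorem IsDelzant.minkComb {P Q : Set (EucSp n)} (hP : IsPolytope P) (hQ : IsDelzant Q)
    (h : DirRefines Q P) {a b : ℝ} (ha : 0 ≤ a) (hb : 0 < b) : IsDelzant (minkComb a b P Q) where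
  isPolytope := hP.minkComb hQ.isPolytope a b
  fullDim := affineSpan_minkComb hP.nonempty hQ.fullDim a hb.ne'
  unimodular := by
    rintro C ⟨F, ⟨α, rfl⟩, rfl⟩
    convert hQ.unimodular _ ⟨_, ⟨α, rfl⟩, rfl⟩ using 1
    ext β
    constructor
    · intro hβ q hq
      obtain ⟨p, hp⟩ := hP.faceDir_nonempty α
      exact mem_faceDir_of_combination hb hp.1 hq.1
        (hβ (combination_mem_faceDir ha hb.le hp hq))
    · intro hβ z hz
      obtain ⟨p, hp, q, hq, rfl⟩ := hz.1
      have hqα := mem_faceDir_of_combination hb hp hq hz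
      rcases ha.eq_or_lt with rfl | ha
      -- For a = 0 the P-component of the point is arbitrary and may be replaced by a maximizer of
      -- β.
      · obtain ⟨p', hp'⟩ := hP.faceDir_nonempty β
        simpa using combination_mem_faceDir le_rfl hb.le hp' (hβ hqα)
      · refine combination_mem_faceDir ha.le hb.le ?_ (hβ hqα)
        rw [minkComb_comm, add_comm] at hz
        exact h.faceDir_subset hQ.isPolytope hβ (mem_faceDir_of_combination ha hq hp hz)

/-! ### Refinement under Hausdorff limits -/

/-- Being refined by a given polytope is a closed condition. -/
theorem dirRefines_of_forall_near {Q : Set (EucSp n)} {P : NonemptyCompacts (EucSp n)}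
    (h : ∀ η > 0, ∃ K : NonemptyCompacts (EucSp n), dist K P < η ∧ DirRefines Q (K : Set (EucSp n))) :
    DirRefines Q (P : Set (EucSp n)) := by
  intro β δ hne
  obtain ⟨x, hx⟩ := faceDir_nonempty P.isCompact P.nonempty (β + δ)
  rw [mem_faceDir_iff] at hx
  have hmem : ∀ α : EucSp n, ∀ K : NonemptyCompacts (EucSp n), ∀ η, dist K P < η →
      (∀ y ∈ P, ∃ y' ∈ K, inner ℝ α y ≤ inner ℝ α y' + ‖α‖ * η) ∧
      (∀ y ∈ K, ∃ y' ∈ P, inner ℝ α y ≤ inner ℝ α y' + ‖α‖ * η) := by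
    intro α K η hη
    have hfin : Metric.hausdorffEDist (K : Set (EucSp n)) P ≠ ⊤ :=
      Metric.hausdorffEDist_ne_top_of_nonempty_of_bounded K.nonempty P.nonempty
        K.isCompact.isBounded P.isCompact.isBounded
    have aux : ∀ y y' : EucSp n, dist y y' < η → inner ℝ α y ≤ inner ℝ α y' + ‖α‖ * η := by
      intro y y' hyy
      have h1 := real_inner_le_norm α (y - y')
      rw [inner_sub_right, ← dist_eq_norm] at h1
      have := mul_le_mul_of_nonneg_left hyy.le (norm_nonneg α)
      linarith
    rw [Metric.NonemptyCompacts.dist_eq] at hη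
    constructor
    · intro y hy
      obtain ⟨y', hy', hd⟩ := Metric.exists_dist_lt_of_hausdorffDist_lt' hy hη hfin
      exact ⟨y', hy', aux _ _ (by rwa [dist_comm])⟩
    · intro y hy
      obtain ⟨y', hy', hd⟩ := Metric.exists_dist_lt_of_hausdorffDist_lt hy hη hfin
      exact ⟨y', hy', aux _ _ hd⟩
  have main : ∀ β δ : EucSp n, (faceDir Q β ∩ faceDir Q δ).Nonempty →
      (∀ y ∈ P, inner ℝ (β + δ) y ≤ inner ℝ (β + δ) x) → x ∈ faceDir (P : Set (EucSp n)) β := by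
    intro β δ hne hmax
    refine mem_faceDir_iff.2 ⟨hx.1, fun y hy => ?_⟩
    -- On a nearby K some z maximizes β and δ. Up to errors, β(y) ≤ β(z), δ(x) ≤ δ(z) and (β + δ)(z)
    -- ≤ (β + δ)(x), so β(y) ≤ β(x). The three errors have norm factors adding up to c - 1; the
    -- extra 1 keeps c positive.
    refine le_of_forall_pos_le_add fun ε hε => ?_
    set c := ‖β‖ + ‖β + δ‖ + ‖δ‖ + 1 with hc
    have hc0 : 0 < c := by positivity
    obtain ⟨K, hK, hr⟩ := h (ε / c) (div_pos hε hc0)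
    obtain ⟨z, hz1, hz2⟩ := hr β δ hne
    rw [mem_faceDir_iff] at hz1 hz2
    obtain ⟨y', hy', e1⟩ := (hmem β K _ hK).1 y hy
    obtain ⟨x', hx', e2⟩ := (hmem δ K _ hK).1 x hx.1
    obtain ⟨z', hz', e3⟩ := (hmem (β + δ) K _ hK).2 z hz1.1
    have e4 := hmax z' hz'
    have e5 := hz1.2 y' hy'
    have e6 := hz2.2 x' hx'
    have e7 : (‖β‖ + ‖β + δ‖ + ‖δ‖ + 1) * (ε / c) = ε := by rw [← hc]; field_simp
    have : 0 < ε / c := div_pos hε hc0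
    simp only [inner_add_left] at e3 e4
    linarith
  refine ⟨x, main β δ hne hx.2, main δ β (by rwa [Set.inter_comm]) ?_⟩
  rw [add_comm]; exact hx.2

/-! ### Lattice bases and unimodular cones -/

theorem inner_intVec (u v : Fin n → ℤ) :
    (inner ℝ (intVec u) (intVec v) : ℝ) = ((u ⬝ᵥ v : ℤ) : ℝ) := by
  simp [intVec, PiLp.inner_apply, dotProduct, mul_comm]

/-- The integer vector as an additive function. -/
def intVecHom (n : ℕ) : (Fin n → ℤ) →+ EucSp n where
  toFun := intVec
  map_zero' := by ext; simp [intVec]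
  map_add' u v := by ext; simp [intVec]

theorem intVec_add (u v : Fin n → ℤ) : intVec (u + v) = intVec u + intVec v :=
  (intVecHom n).map_add u v

theorem intVec_neg (u : Fin n → ℤ) : intVec (-u) = -intVec u := (intVecHom n).map_neg u

theorem intVec_sum {ι : Type*} (s : Finset ι) (f : ι → Fin n → ℤ) :
    intVec (∑ i ∈ s, f i) = ∑ i ∈ s, intVec (f i) := map_sum (intVecHom n) f s

theorem intVec_zsmul (k : ℤ) (u : Fin n → ℤ) : intVec (k • u) = (k : ℝ) • intVec u := by
  ext; simp [intVec]

section Basis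

variable {ι : Type*} (b : Module.Basis ι ℤ (Fin n → ℤ))

/-- The integer vector representing the `i`-th coordinate of a lattice basis. -/
noncomputable def dualVec (i : ι) : Fin n → ℤ := fun k => b.coord i (Pi.single k 1)

theorem dualVec_dotProduct (i : ι) (z : Fin n → ℤ) : dualVec b i ⬝ᵥ z = b.coord i z := by
  rw [(b.coord i).pi_apply_eq_sum_univ z]
  refine Finset.sum_congr rfl fun k _ => ?_
  rw [smul_eq_mul, mul_comm, dualVec]
  congr 2
  ext j
  simp [Pi.single_apply, eq_comm]

/-- Both sides are real-linear in x, and on the standard vectors this is the integral basis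
expansion. -/
theorem sum_inner_dualVec [Fintype ι] (x : EucSp n) :
    ∑ i, (inner ℝ (intVec (dualVec b i)) x : ℝ) • intVec (b i) = x := by
  let L : EucSp n →ₗ[ℝ] EucSp n :=
    ∑ i, ((innerₗ (EucSp n)) (intVec (dualVec b i))).smulRight (intVec (b i))
  have hL : L = LinearMap.id := by
    refine (EuclideanSpace.basisFun (Fin n) ℝ).toBasis.ext fun k => ?_
    have hk : (EuclideanSpace.basisFun (Fin n) ℝ).toBasis k = intVec (Pi.single k 1) := by
      ext j
      simp [intVec, Pi.single_apply]
    rw [hk, LinearMap.id_apply]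
    conv_rhs => rw [← b.sum_repr (Pi.single k 1), intVec_sum]
    simp only [intVec_zsmul]
    simp only [L, LinearMap.sum_apply, LinearMap.smulRight_apply, innerₗ_apply_apply,
      inner_intVec, dualVec_dotProduct, Module.Basis.coord_apply]
  simpa [L] using LinearMap.congr_fun hL x

theorem inner_dualVec_basis [DecidableEq ι] (i j : ι) :
    (inner ℝ (intVec (dualVec b i)) (intVec (b j)) : ℝ) = if j = i then 1 else 0 := by
  rw [inner_intVec, dualVec_dotProduct]
  simp [Finsupp.single_apply]

theorem linearIndependent_intVec_basis [Fintype ι] : LinearIndependent ℝ fun i => intVec (b i) := by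
  classical
  rw [Fintype.linearIndependent_iff]
  intro g hg i
  have := congrArg (fun x => (inner ℝ (intVec (dualVec b i)) x : ℝ)) hg
  simpa [inner_sum, inner_smul_right, inner_dualVec_basis] using this

end Basis

theorem mem_hull_range_iff {m : ℕ} (v : Fin m → EucSp n) (x : EucSp n) :
    x ∈ PointedCone.hull ℝ (Set.range v) ↔ ∃ c : Fin m → ℝ, (∀ i, 0 ≤ c i) ∧ ∑ i, c i • v i = x := by
  rw [PointedCone.hull, Submodule.mem_span_range_iff_exists_fun]
  constructor
  · rintro ⟨c, rfl⟩
    exact ⟨fun i => c i, fun i => (c i).2, rfl⟩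
  · rintro ⟨c, hc, rfl⟩
    exact ⟨fun i => ⟨c i, hc i⟩, rfl⟩

/-- A unimodular cone is cut out by finitely many integral inequalities. -/
theorem IsUnimodularCone.exists_finset {C : Set (EucSp n)} (hC : IsUnimodularCone C) :
    ∃ T : Finset (Fin n → ℤ), C = {α | ∀ m ∈ T, 0 ≤ (inner ℝ (intVec m) α : ℝ)} := by
  classical
  obtain ⟨m, v, hli, rfl, hsat⟩ := hC
  set W := Submodule.span ℤ (Set.range v) with hW
  have hliZ : LinearIndependent ℤ v := by
    rw [Fintype.linearIndependent_iff]
    intro g hg i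
    have h1 := congrArg intVec hg
    rw [intVec_sum] at h1
    simp only [intVec_zsmul] at h1
    have := Fintype.linearIndependent_iff.1 hli (fun i => (g i : ℝ)) (by
      rw [h1]; exact (intVecHom n).map_zero) i
    exact_mod_cast this
  have hmem : ∀ z ∈ W, intVec z ∈ Submodule.span ℝ (Set.range fun i => intVec (v i)) := by
    intro z hz
    obtain ⟨c, rfl⟩ := (Submodule.mem_span_range_iff_exists_fun ℤ).1 hz
    rw [intVec_sum]
    refine Submodule.sum_mem _ fun i _ => ?_
    rw [intVec_zsmul]
    exact Submodule.smul_mem _ _ (Submodule.subset_span ⟨i, rfl⟩)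
  have hsub : Set.range (fun i => intVec (v i)) ⊆
      (PointedCone.hull ℝ (Set.range fun i => intVec (v i)) : Set (EucSp n)) :=
    Submodule.subset_span
  -- The lattice condition makes W saturated, so the quotient is free and the generators extend to a
  -- lattice basis.
  have htf : Module.IsTorsionFree ℤ ((Fin n → ℤ) ⧸ W) := by
    refine .of_smul_eq_zero fun k z hz => ?_
    obtain ⟨z, rfl⟩ := W.mkQ_surjective z
    rw [or_iff_not_imp_left]
    intro hk
    rw [← map_smul, Submodule.mkQ_apply, Submodule.Quotient.mk_eq_zero] at hz
    rw [Submodule.mkQ_apply, Submodule.Quotient.mk_eq_zero]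
    have h1 := hmem _ hz
    rw [intVec_zsmul, Submodule.smul_mem_iff _ (by exact_mod_cast hk)] at h1
    exact hsat z (Submodule.span_mono hsub h1)
  let bQ := Module.Free.chooseBasis ℤ ((Fin n → ℤ) ⧸ W)
  let b := (Module.Basis.span hliZ).sumQuot bQ
  have hb : ∀ i, b (Sum.inl i) = v i := by
    intro i
    simp only [b, Module.Basis.sumQuot_inl]
    exact congrArg Subtype.val (Module.Basis.span_apply hliZ i) 
  -- All coordinates are nonnegative; those along the added basis vectors also occur with the
  -- opposite sign, which forces them to vanish.
  refine ⟨(Finset.univ.image fun i => dualVec b i) ∪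
    (Finset.univ.image fun k => -dualVec b (Sum.inr k)), ?_⟩
  ext α
  simp only [SetLike.mem_coe, mem_hull_range_iff, Set.mem_ofPred_eq, Finset.mem_union,
    Finset.mem_image, Finset.mem_univ, true_and]
  constructor
  · rintro ⟨c, hc, rfl⟩ z hz
    have key : ∀ i, (inner ℝ (intVec (dualVec b i)) (∑ i, c i • intVec (v i)) : ℝ) =
        Sum.elim c 0 i := by
      intro i
      simp only [inner_sum, inner_smul_right, ← hb, inner_dualVec_basis]
      rcases i with i | k <;> simp
    rcases hz with ⟨i, rfl⟩ | ⟨k, rfl⟩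
    · rw [key]
      rcases i with i | k
      · exact hc i
      · simp
    · rw [intVec_neg, inner_neg_left, key]; simp
  · intro h
    refine ⟨fun i => inner ℝ (intVec (dualVec b (Sum.inl i))) α, fun i => h _ (Or.inl ⟨_, rfl⟩), ?_⟩
    conv_rhs => rw [← sum_inner_dualVec b α, Fintype.sum_sum_type]
    simp only [hb]
    rw [left_eq_add]
    refine Finset.sum_eq_zero fun k _ => ?_
    have h1 := h _ (Or.inl ⟨Sum.inr k, rfl⟩)
    have h2 := h _ (Or.inr ⟨k, rfl⟩)
    rw [intVec_neg, inner_neg_left] at h2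
    rw [show (inner ℝ (intVec (dualVec b (Sum.inr k))) α : ℝ) = 0 by linarith, zero_smul]

/-- Part of a lattice basis generates a unimodular cone. -/
theorem isUnimodularCone_hull_of_subset_basis {U : Set (Fin n → ℤ)}
    {b : Module.Basis (Fin n) ℤ (Fin n → ℤ)} (hU : U ⊆ Set.range b) :
    IsUnimodularCone (PointedCone.hull ℝ (intVec '' U) : Set (EucSp n)) := by
  classical
  let J : Finset (Fin n) := Finset.univ.filter fun i => b i ∈ U
  let e : Fin J.card ≃ J := J.equivFin.symm
  have hr : Set.range (fun i => b (e i)) = U := by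
    ext z
    constructor
    · rintro ⟨i, rfl⟩
      exact (Finset.mem_filter.1 (e i).2).2
    · intro hz
      obtain ⟨j, rfl⟩ := hU hz
      exact ⟨e.symm ⟨j, Finset.mem_filter.2 ⟨Finset.mem_univ _, hz⟩⟩, by simp⟩
  have hr' : Set.range (fun i => intVec (b (e i))) = intVec '' U := by
    rw [← hr, ← Set.range_comp]; rfl
  refine ⟨J.card, fun i => b (e i), ?_, by rw [hr'], ?_⟩
  · exact (linearIndependent_intVec_basis b).comp (fun i => (e i : Fin n))
      (Subtype.val_injective.comp e.injective)
  · intro z hz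
    have hz' : ∀ j ∉ J, b.coord j z = 0 := by
      intro j hj
      have hle : Submodule.span ℝ ((PointedCone.hull ℝ (intVec '' U)) : Set (EucSp n)) ≤
          LinearMap.ker (innerₗ (EucSp n) (intVec (dualVec b j))) := by
        rw [Submodule.span_le]
        have : PointedCone.hull ℝ (intVec '' U) ≤
          (LinearMap.ker (innerₗ (EucSp n) (intVec (dualVec b j)))).restrictScalars _ := by
          refine Submodule.span_le.2 ?_
          rintro _ ⟨w, hw, rfl⟩
          obtain ⟨i, rfl⟩ := hU hw
          have hij : i ≠ j := by
            rintro rfl; exact hj (Finset.mem_filter.2 ⟨Finset.mem_univ _, hw⟩)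
          simp [inner_dualVec_basis, hij]
        exact this
      have h0 := hle hz
      rw [LinearMap.mem_ker, innerₗ_apply_apply, inner_intVec, dualVec_dotProduct] at h0
      exact_mod_cast h0
    rw [← b.sum_repr z]
    refine Submodule.sum_mem _ fun j _ => ?_
    by_cases hj : j ∈ J
    · exact Submodule.smul_mem _ _ (Submodule.subset_span ⟨e.symm ⟨j, hj⟩, by simp⟩)
    · have := hz' j hj
      rw [Module.Basis.coord_apply] at this
      rw [this, zero_smul]
      exact Submodule.zero_mem _

/-- In a lattice basis, `bᵢ` may be replaced by `bᵢ + bⱼ`. -/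
theorem exists_basis_replace (b : Module.Basis (Fin n) ℤ (Fin n → ℤ)) {i j : Fin n} (hij : i ≠ j) :
    ∃ b' : Module.Basis (Fin n) ℤ (Fin n → ℤ), b' i = b i + b j ∧ ∀ k, k ≠ i → b' k = b k := by
  refine ⟨b.map (LinearEquiv.transvection (f := b.coord i) (v := b j) (by simp [hij.symm])), ?_, ?_⟩
  · simp [LinearEquiv.transvection, LinearMap.transvection.apply]
  · intro k hk
    simp [LinearEquiv.transvection, LinearMap.transvection.apply, hk]

/-! ### Smooth systems of inequalities -/

/-- The polyhedron of a finite system of inequalities `⟨v, x⟩ ≤ c` with integral normals. -/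
def hPoly (A : Finset ((Fin n → ℤ) × ℝ)) : Set (EucSp n) :=
  {x | ∀ a ∈ A, inner ℝ (intVec a.1) x ≤ a.2}

/-- The normals of the inequalities that are tight at `x`. -/
def activeSet (A : Finset ((Fin n → ℤ) × ℝ)) (x : EucSp n) : Set (Fin n → ℤ) :=
  {v | (v, (inner ℝ (intVec v) x : ℝ)) ∈ A}

/-- A bounded system with a strictly feasible point, whose tight normals at any feasible point are
part of a lattice basis. -/
structure IsSmoothSystem (A : Finset ((Fin n → ℤ) × ℝ)) : Prop where
  bounded : Bornology.IsBounded (hPoly A)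
  strict : ∃ x, ∀ a ∈ A, inner ℝ (intVec a.1) x < a.2
  smooth : ∀ x ∈ hPoly A, ∃ b : Module.Basis (Fin n) ℤ (Fin n → ℤ), activeSet A x ⊆ Set.range b

variable {A : Finset ((Fin n → ℤ) × ℝ)}

theorem finite_activeSet (A : Finset ((Fin n → ℤ) × ℝ)) (x : EucSp n) :
    (activeSet A x).Finite := by
  classical
  refine (A.image Prod.fst).finite_toSet.subset fun v hv => ?_
  exact Finset.mem_coe.2 (Finset.mem_image.2 ⟨_, hv, rfl⟩)

theorem hPoly_eq_iInter (A : Finset ((Fin n → ℤ) × ℝ)) :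
    hPoly A = ⋂ a ∈ A, {x | (inner ℝ (intVec a.1) x : ℝ) ≤ a.2} := by
  ext; simp [hPoly]

theorem isClosed_hPoly (A : Finset ((Fin n → ℤ) × ℝ)) : IsClosed (hPoly A) := by
  rw [hPoly_eq_iInter]
  exact isClosed_biInter fun a _ => isClosed_le (by fun_prop) continuous_const

theorem convex_hPoly (A : Finset ((Fin n → ℤ) × ℝ)) : Convex ℝ (hPoly A) := by
  rw [hPoly_eq_iInter]
  exact convex_iInter₂ fun a _ => convex_halfSpace_le (innerₗ (EucSp n) (intVec a.1)).isLinear a.2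

theorem IsSmoothSystem.isCompact (hA : IsSmoothSystem A) : IsCompact (hPoly A) :=
  Metric.isCompact_of_isClosed_isBounded (isClosed_hPoly A) hA.bounded

/-- A direction which does not leave the tight half-spaces is feasible. -/
theorem eventually_add_smul_mem_hPoly {x d : EucSp n} (hx : x ∈ hPoly A)
    (hd : ∀ v ∈ activeSet A x, (inner ℝ (intVec v) d : ℝ) ≤ 0) :
    ∀ᶠ ε : ℝ in nhdsWithin 0 (Set.Ioi 0), x + ε • d ∈ hPoly A := by
  refine (Filter.eventually_all_finset A).2 fun a ha => ?_
  simp only [inner_add_right, inner_smul_right]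
  rcases (hx a ha).eq_or_lt with e | e
  · filter_upwards [self_mem_nhdsWithin] with ε hε
    have := hd a.1 (by simp only [activeSet, Set.mem_ofPred_eq, e]; exact ha)
    have := mul_nonpos_of_nonneg_of_nonpos (le_of_lt hε) this
    linarith
  · have hc : Continuous fun ε : ℝ =>
        (inner ℝ (intVec a.1) x : ℝ) + ε * inner ℝ (intVec a.1) d := by fun_prop
    have h0 := (hc.tendsto 0).eventually (eventually_lt_nhds (b := a.2) (by simpa using e))
    exact (h0.filter_mono nhdsWithin_le_nhds).mono fun ε h => h.le

theorem tight_of_mem_activeSet {x y : EucSp n} {v : Fin n → ℤ} (hx : x ∈ hPoly A)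
    (hy : y ∈ hPoly A) (h1 : v ∈ activeSet A x) (h2 : v ∈ activeSet A y) :
    (inner ℝ (intVec v) x : ℝ) = inner ℝ (intVec v) y :=
  le_antisymm (hx _ h2) (hy _ h1)

theorem mem_activeSet_of_le {x y : EucSp n} {v : Fin n → ℤ} (hx : x ∈ hPoly A)
    (hv : v ∈ activeSet A y) (h : (inner ℝ (intVec v) y : ℝ) ≤ inner ℝ (intVec v) x) :
    v ∈ activeSet A x := by
  have := le_antisymm h (hx _ hv)
  simp only [activeSet, Set.mem_ofPred_eq] at hv ⊢
  rwa [← this]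

/-- The vector y - x is orthogonal to all normals tight at x, so x can move a little both ways along
it; extremality forces it to be zero. -/
theorem eq_of_mem_extremePoints {x y : EucSp n} (hx : x ∈ (hPoly A).extremePoints ℝ)
    (hy : y ∈ hPoly A) (h : activeSet A x ⊆ activeSet A y) : x = y := by
  have hz : ∀ v ∈ activeSet A x, (inner ℝ (intVec v) (y - x) : ℝ) = 0 := by
    intro v hv
    rw [inner_sub_right, tight_of_mem_activeSet hx.1 hy hv (h hv), sub_self]
  have h1 := eventually_add_smul_mem_hPoly hx.1 fun v hv => (hz v hv).le
  have h2 := eventually_add_smul_mem_hPoly (d := -(y - x)) hx.1 fun v hv => by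
    rw [inner_neg_right, hz v hv, neg_zero]
  obtain ⟨ε, ⟨hε1, hε2⟩, hε⟩ := ((h1.and h2).and self_mem_nhdsWithin).exists
  have hε : (0 : ℝ) < ε := hε
  have := hx.2 hε1 hε2 ⟨1 / 2, 1 / 2, by norm_num, by norm_num, by norm_num, by module⟩
  have h3 : ε • (y - x) = 0 := by simpa using this
  rcases smul_eq_zero.1 h3 with h | h
  · exact absurd h hε.ne'
  · exact (sub_eq_zero.1 h).symm

/-- Extreme points are determined by their tight normals, hence finite in number; Krein–Milman does
the rest. -/
theorem IsSmoothSystem.isPolytope (hA : IsSmoothSystem A) : IsPolytope (hPoly A) := by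
  classical
  have hfin : ((hPoly A).extremePoints ℝ).Finite := by
    refine Set.Finite.of_finite_image (f := activeSet A)
      ((A.image Prod.fst).finite_toSet.finite_subsets.subset ?_) ?_
    · rintro _ ⟨x, -, rfl⟩ v hv
      exact Finset.mem_coe.2 (Finset.mem_image.2 ⟨_, hv, rfl⟩)
    · intro x hx y hy hxy
      exact eq_of_mem_extremePoints hx hy.1 hxy.subset
  have hne : (hPoly A).Nonempty := by
    obtain ⟨x, hx⟩ := hA.strict
    exact ⟨x, fun a ha => (hx a ha).le⟩
  refine ⟨hfin.toFinset, ?_, ?_⟩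
  · simpa using hA.isCompact.extremePoints_nonempty hne
  · have := closure_convexHull_extremePoints hA.isCompact (convex_hPoly A)
    rw [(hfin.isClosed_convexHull ℝ).closure_eq] at this
    rw [Set.Finite.coe_toFinset, this]

theorem mem_faceDir_of_mem_hull {P V : Set (EucSp n)} {p β : EucSp n} (hp : p ∈ P)
    (h : ∀ v ∈ V, p ∈ faceDir P v) (hβ : β ∈ PointedCone.hull ℝ V) : p ∈ faceDir P β := by
  induction hβ using Submodule.span_induction with
  | mem v hv => exact h v hv
  | zero => exact ⟨hp, by simp⟩
  | add v w _ _ h1 h2 =>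
    refine ⟨hp, fun x hx => ?_⟩
    rw [inner_add_left]
    exact add_nonneg (h1.2 x hx) (h2.2 x hx)
  | smul c v _ h1 =>
    refine ⟨hp, fun x hx => ?_⟩
    have : (inner ℝ (c • v) (p - x) : ℝ) = c * inner ℝ v (p - x) := real_inner_smul_left _ _ _
    rw [this]
    exact mul_nonneg c.2 (h1.2 x hx)

/-- The normal cone at a point is generated by the tight normals. -/
theorem IsSmoothSystem.mem_hull_of_mem_faceDir (hA : IsSmoothSystem A) {x β : EucSp n}
    (hx : x ∈ faceDir (hPoly A) β) : β ∈ PointedCone.hull ℝ (intVec '' activeSet A x) := by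
  classical
  rw [mem_faceDir_iff] at hx
  obtain ⟨b, hb⟩ := hA.smooth x hx.1
  -- β is nonpositive on all feasible directions at x. Testing it on the dual basis vectors gives
  -- the signs of its coordinates.
  have key : ∀ d : EucSp n, (∀ v ∈ activeSet A x, (inner ℝ (intVec v) d : ℝ) ≤ 0) →
      (inner ℝ d β : ℝ) ≤ 0 := by
    intro d hd
    obtain ⟨ε, hε, hε0⟩ := ((eventually_add_smul_mem_hPoly hx.1 hd).and self_mem_nhdsWithin).exists
    have hε0 : (0 : ℝ) < ε := hε0
    have := hx.2 _ hε
    rw [inner_add_right, inner_smul_right] at this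
    rw [real_inner_comm]
    by_contra! hc
    have := mul_pos hε0 hc
    linarith
  rw [← sum_inner_dualVec b β]
  refine Submodule.sum_mem _ fun i _ => ?_
  have h1 : 0 ≤ (inner ℝ (intVec (dualVec b i)) β : ℝ) := by
    have := key (-intVec (dualVec b i)) fun v hv => by
      obtain ⟨j, rfl⟩ := hb hv
      rw [inner_neg_right, real_inner_comm, inner_dualVec_basis]
      split_ifs <;> simp
    rw [inner_neg_left] at this
    linarith
  by_cases hi : b i ∈ activeSet A x
  · exact Submodule.smul_mem _ (⟨_, h1⟩ : {c : ℝ // 0 ≤ c}) (Submodule.subset_span ⟨_, hi, rfl⟩)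
  · have h2 := key (intVec (dualVec b i)) fun v hv => by
      obtain ⟨j, rfl⟩ := hb hv
      have : j ≠ i := by rintro rfl; exact hi hv
      rw [real_inner_comm, inner_dualVec_basis, if_neg this]
    rw [le_antisymm h2 h1, zero_smul]
    exact Submodule.zero_mem _

theorem IsSmoothSystem.isDelzant (hA : IsSmoothSystem A) : IsDelzant (hPoly A) where
  isPolytope := hA.isPolytope
  fullDim := by
    obtain ⟨x, hx⟩ := hA.strict
    have hopen : IsOpen {y : EucSp n | ∀ a ∈ A, (inner ℝ (intVec a.1) y : ℝ) < a.2} := by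
      have : {y : EucSp n | ∀ a ∈ A, (inner ℝ (intVec a.1) y : ℝ) < a.2} =
          ⋂ a ∈ A, {y | (inner ℝ (intVec a.1) y : ℝ) < a.2} := by ext; simp
      rw [this]
      exact isOpen_biInter_finset fun a _ => isOpen_lt (by fun_prop) continuous_const
    have h := hopen.affineSpan_eq_top ⟨x, hx⟩
    exact top_le_iff.1 (h ▸ affineSpan_mono ℝ fun y hy a ha => (hy a ha).le)
  unimodular := by
    rintro C ⟨F, ⟨α, rfl⟩, rfl⟩
    -- A point of the face with fewest tight normals is in effect relatively interior: a normal
    -- tight at a midpoint is tight at both ends, so by minimality the normals tight at x are tight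
    -- on the whole face.
    obtain ⟨x, hx, hmin⟩ := (measure fun x => (activeSet A x).ncard).wf.has_min _
      (hA.isPolytope.faceDir_nonempty α)
    have hsub : ∀ y ∈ faceDir (hPoly A) α, activeSet A x ⊆ activeSet A y := by
      intro y hy
      set z : EucSp n := (1 / 2 : ℝ) • x + (1 / 2 : ℝ) • y with hz
      have hzP : z ∈ hPoly A := convex_hPoly A hx.1 hy.1 (by norm_num) (by norm_num) (by norm_num)
      have hzα : z ∈ faceDir (hPoly A) α := by
        rw [mem_faceDir_iff] at hx hy ⊢
        refine ⟨hzP, fun t ht => ?_⟩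
        simp only [hz, inner_add_right, inner_smul_right]
        linarith [hx.2 t ht, hy.2 t ht]
      have key : ∀ v ∈ activeSet A z, v ∈ activeSet A x ∧ v ∈ activeSet A y := by
        intro v hv
        have h1 := hx.1 _ hv
        have h2 := hy.1 _ hv
        have h3 : (inner ℝ (intVec v) z : ℝ) =
          1 / 2 * inner ℝ (intVec v) x + 1 / 2 * inner ℝ (intVec v) y := by
          simp only [hz, inner_add_right, inner_smul_right]
        exact ⟨mem_activeSet_of_le hx.1 hv (by dsimp only at *; linarith),
          mem_activeSet_of_le hy.1 hv (by dsimp only at *; linarith)⟩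
      have heq : activeSet A z = activeSet A x :=
        Set.eq_of_subset_of_ncard_le (fun v hv => (key v hv).1)
          (not_lt.1 (hmin z hzα)) (finite_activeSet A x)
      exact fun v hv => (key v (heq ▸ hv)).2
    obtain ⟨b, hb⟩ := hA.smooth x hx.1
    convert isUnimodularCone_hull_of_subset_basis hb
    ext β
    constructor
    · exact fun h => hA.mem_hull_of_mem_faceDir (h hx)
    · intro h y hy
      refine mem_faceDir_of_mem_hull hy.1 ?_ h
      rintro _ ⟨v, hv, rfl⟩
      exact mem_faceDir_iff.2 ⟨hy.1, fun t ht => ht _ (hsub y hy hv)⟩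

/-! ### Chopping off faces of codimension two -/

/-- On each of the finitely many faces given by tight inequalities, u either reaches h or has
maximum strictly below h. A level c close enough to h lies above all the latter maxima, so a cut at
c meets only faces that reach h. -/
theorem IsSmoothSystem.eventually_exists_tight (hA : IsSmoothSystem A) (u : EucSp n) (h : ℝ) :
    ∀ᶠ c : ℝ in nhdsWithin h (Set.Iio h), ∀ x ∈ hPoly A, c ≤ inner ℝ u x →
      ∃ z ∈ hPoly A, activeSet A x ⊆ activeSet A z ∧ h ≤ inner ℝ u z := by
  classical
  have key : ∀ J ∈ A.powerset, ∀ᶠ c : ℝ in nhdsWithin h (Set.Iio h), ∀ x ∈ hPoly A,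
      (∀ a ∈ J, (inner ℝ (intVec a.1) x : ℝ) = a.2) → c ≤ inner ℝ u x →
      ∃ z ∈ hPoly A, (∀ a ∈ J, (inner ℝ (intVec a.1) z : ℝ) = a.2) ∧ h ≤ inner ℝ u z := by
    intro J _
    by_cases hz : ∃ z ∈ hPoly A, (∀ a ∈ J, (inner ℝ (intVec a.1) z : ℝ) = a.2) ∧ h ≤ inner ℝ u z
    · exact Filter.Eventually.of_forall fun c x _ _ _ => hz
    · push Not at hz
      set K := hPoly A ∩ {x | ∀ a ∈ J, (inner ℝ (intVec a.1) x : ℝ) = a.2} with hK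
      have hKc : IsCompact K := by
        refine hA.isCompact.inter_right ?_
        have : {x | ∀ a ∈ J, (inner ℝ (intVec a.1) x : ℝ) = a.2} =
          ⋂ a ∈ J, {x | (inner ℝ (intVec a.1) x : ℝ) = a.2} := by ext; simp
        rw [this]
        exact isClosed_biInter fun a _ => isClosed_eq (by fun_prop) continuous_const
      rcases K.eq_empty_or_nonempty with he | hne
      · refine Filter.Eventually.of_forall fun c x h1 h2 _ => ?_
        exact absurd (show x ∈ K from ⟨h1, h2⟩) (by simp [he])
      · have hc : Continuous fun x : EucSp n => (inner ℝ u x : ℝ) := by fun_prop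
        obtain ⟨x₁, hx₁, hmax⟩ := hKc.exists_isMaxOn hne hc.continuousOn
        filter_upwards [Ioo_mem_nhdsLT (hz x₁ hx₁.1 hx₁.2)] with c hcI x h1 h2 h3
        exact absurd (hmax (show x ∈ K from ⟨h1, h2⟩)) (by
          simp only [Set.mem_ofPred_eq, not_le]; exact hcI.1.trans_le h3)
  filter_upwards [(Filter.eventually_all_finset _).2 key] with c hc x hx hcx
  obtain ⟨z, hz, h1, h2⟩ := hc (A.filter fun a => (inner ℝ (intVec a.1) x : ℝ) = a.2)
    (Finset.mem_powerset.2 (Finset.filter_subset _ _)) x hx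
    (fun a ha => (Finset.mem_filter.1 ha).2) hcx
  refine ⟨z, hz, fun v hv => ?_, h2⟩
  exact mem_activeSet_of_le hz hv (h1 _ (Finset.mem_filter.2 ⟨hv, rfl⟩)).ge

/-- Cutting off a face of codimension two. -/
theorem IsSmoothSystem.exists_chop (hA : IsSmoothSystem A) {u w : Fin n → ℤ} (huw : u ≠ w)
    {y : EucSp n} (hy : y ∈ hPoly A) (hu : u ∈ activeSet A y) (hw : w ∈ activeSet A y) :
    ∃ A', IsSmoothSystem A' ∧ hPoly A' ⊆ hPoly A ∧ ∀ x ∈ hPoly A',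
      ¬ (u ∈ activeSet A x ∧ w ∈ activeSet A x) ∧
      ∀ v ∈ activeSet A' x, v ∈ activeSet A x ∨
        (v = u + w ∧ ∃ z ∈ hPoly A, activeSet A x ⊆ activeSet A z ∧
          u ∈ activeSet A z ∧ w ∈ activeSet A z) := by
  classical
  obtain ⟨x₀, hx₀⟩ := hA.strict
  -- h is the maximum of u + w, attained exactly where u and w are both tight.
  obtain ⟨h, hh⟩ : ∃ h : ℝ, h = inner ℝ (intVec (u + w)) y := ⟨_, rfl⟩
  have hsplit : ∀ x : EucSp n, (inner ℝ (intVec (u + w)) x : ℝ) =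
      inner ℝ (intVec u) x + inner ℝ (intVec w) x := fun x => by
    rw [intVec_add, inner_add_left]
  have hx₀h : (inner ℝ (intVec (u + w)) x₀ : ℝ) < h := by
    have h1 := hx₀ _ hu
    have h2 := hx₀ _ hw
    rw [hh, hsplit, hsplit]
    exact add_lt_add h1 h2
  obtain ⟨c, hc, hcI⟩ := ((hA.eventually_exists_tight (intVec (u + w)) h).and
    (Ioo_mem_nhdsLT hx₀h)).exists
  have hle : hPoly (insert (u + w, c) A) ⊆ hPoly A := fun x hx a ha =>
    hx a (Finset.mem_insert_of_mem ha)
  have hnot : ∀ x ∈ hPoly (insert (u + w, c) A),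
      ¬ (u ∈ activeSet A x ∧ w ∈ activeSet A x) := by
    rintro x hx ⟨h1, h2⟩
    have e1 := tight_of_mem_activeSet (hle hx) hy h1 hu
    have e2 := tight_of_mem_activeSet (hle hx) hy h2 hw
    have e3 : (inner ℝ (intVec (u + w)) x : ℝ) ≤ c :=
      hx (u + w, c) (Finset.mem_insert_self _ _)
    rw [hsplit, e1, e2, ← hsplit, ← hh] at e3
    exact absurd hcI.2 (not_lt.2 e3)
  have hact : ∀ x ∈ hPoly (insert (u + w, c) A), ∀ v ∈ activeSet (insert (u + w, c) A) x,
      v ∈ activeSet A x ∨ (v = u + w ∧ (inner ℝ (intVec (u + w)) x : ℝ) = c) := by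
    intro x hx v hv
    have hv' : (v, (inner ℝ (intVec v) x : ℝ)) = (u + w, c) ∨
      (v, (inner ℝ (intVec v) x : ℝ)) ∈ A := Finset.mem_insert.1 hv
    rcases hv' with e | e
    · have e1 : v = u + w := congrArg Prod.fst e
      have e2 : (inner ℝ (intVec v) x : ℝ) = c := congrArg Prod.snd e
      exact Or.inr ⟨e1, e1 ▸ e2⟩
    · exact Or.inl e
  have htight : ∀ x ∈ hPoly (insert (u + w, c) A), (inner ℝ (intVec (u + w)) x : ℝ) = c →
      ∃ z ∈ hPoly A, activeSet A x ⊆ activeSet A z ∧ u ∈ activeSet A z ∧ w ∈ activeSet A z := by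
    intro x hx hxc
    obtain ⟨z, hz, hs, hzh⟩ := hc x (hle hx) hxc.ge
    have h1 : (inner ℝ (intVec u) z : ℝ) ≤ inner ℝ (intVec u) y := hz _ hu
    have h2 : (inner ℝ (intVec w) z : ℝ) ≤ inner ℝ (intVec w) y := hz _ hw
    rw [hh, hsplit, hsplit] at hzh
    exact ⟨z, hz, hs, mem_activeSet_of_le hz hu (by linarith),
      mem_activeSet_of_le hz hw (by linarith)⟩
  refine ⟨insert (u + w, c) A, ⟨hA.bounded.subset hle, ⟨x₀, ?_⟩, ?_⟩, hle, fun x hx =>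
    ⟨hnot x hx, fun v hv => (hact x hx v hv).imp_right fun h => ⟨h.1, htight x hx h.2⟩⟩⟩
  · intro a ha
    rcases Finset.mem_insert.1 ha with rfl | ha
    · exact hcI.1
    · exact hx₀ a ha
  · intro x hx
    by_cases hxc : (inner ℝ (intVec (u + w)) x : ℝ) = c
    · obtain ⟨z, hz, hs, hzu, hzw⟩ := htight x hx hxc
      obtain ⟨b, hb⟩ := hA.smooth z hz
      obtain ⟨i, rfl⟩ := hb hzu
      obtain ⟨j, rfl⟩ := hb hzw
      have hij : i ≠ j := fun e => huw (by rw [e])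
      -- On the cut at most one of the two normals stays tight; a missing one is exchanged for their
      -- sum in the basis at z.
      have main : ∀ i j : Fin n, i ≠ j → b i ∉ activeSet A x →
          ∃ b' : Module.Basis (Fin n) ℤ (Fin n → ℤ), b i + b j ∈ Set.range b' ∧
            activeSet A x ⊆ Set.range b' := by
        intro i j hij hi
        obtain ⟨b', h1, h2⟩ := exists_basis_replace b hij
        refine ⟨b', ⟨i, h1⟩, fun v hv => ?_⟩
        obtain ⟨k, rfl⟩ := hb (hs hv)
        exact ⟨k, h2 k (by rintro rfl; exact hi hv)⟩
      have : ∃ b' : Module.Basis (Fin n) ℤ (Fin n → ℤ), b i + b j ∈ Set.range b' ∧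
            activeSet A x ⊆ Set.range b' := by
        by_cases hi : b i ∈ activeSet A x
        · rw [add_comm]
          exact main j i hij.symm fun hj => hnot x hx ⟨hi, hj⟩
        · exact main i j hij hi
      obtain ⟨b', h1, h2⟩ := this
      refine ⟨b', fun v hv => ?_⟩
      rcases hact x hx v hv with h | ⟨rfl, -⟩
      · exact h2 h
      · exact h1
    · obtain ⟨b, hb⟩ := hA.smooth x (hle hx)
      refine ⟨b, fun v hv => ?_⟩
      rcases hact x hx v hv with h | h
      · exact hb h
      · exact absurd h.2 hxc

/-! ### Bad pairs and their removal -/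

/-- Two normals that are tight at a common feasible point and strictly separated by `m`. -/
def IsBadPair (A : Finset ((Fin n → ℤ) × ℝ)) (m u w : Fin n → ℤ) : Prop :=
  (∃ x ∈ hPoly A, u ∈ activeSet A x ∧ w ∈ activeSet A x) ∧ 0 < m ⬝ᵥ u ∧ m ⬝ᵥ w < 0

theorem finite_setOf_isBadPair (A : Finset ((Fin n → ℤ) × ℝ)) (m : Fin n → ℤ) :
    {p : (Fin n → ℤ) × (Fin n → ℤ) | IsBadPair A m p.1 p.2}.Finite := by
  classical
  refine ((A.image Prod.fst) ×ˢ (A.image Prod.fst)).finite_toSet.subset ?_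
  rintro ⟨u, w⟩ ⟨⟨x, -, hu, hw⟩, -⟩
  exact Finset.mem_coe.2 (Finset.mem_product.2
    ⟨Finset.mem_image.2 ⟨_, hu, rfl⟩, Finset.mem_image.2 ⟨_, hw, rfl⟩⟩)

/-- A maximal bad pair can be removed without creating new bad pairs of at least the same size. -/
theorem IsSmoothSystem.exists_chop_isBadPair (hA : IsSmoothSystem A) {m u w : Fin n → ℤ}
    (huw : IsBadPair A m u w)
    (hmax : ∀ a b, IsBadPair A m a b → m ⬝ᵥ a - m ⬝ᵥ b ≤ m ⬝ᵥ u - m ⬝ᵥ w) :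
    ∃ A', IsSmoothSystem A' ∧ ¬ IsBadPair A' m u w ∧
      (∀ a b, IsBadPair A' m a b →
        IsBadPair A m a b ∨ m ⬝ᵥ a - m ⬝ᵥ b < m ⬝ᵥ u - m ⬝ᵥ w) ∧
      ∀ m', (∀ a b, ¬ IsBadPair A m' a b) → ∀ a b, ¬ IsBadPair A' m' a b := by
  obtain ⟨⟨y, hy, hu, hw⟩, hmu, hmw⟩ := huw
  have hne : u ≠ w := by rintro rfl; exact absurd hmu hmw.not_gt
  obtain ⟨A', hA', hle, hact⟩ := hA.exists_chop hne hy hu hw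
  refine ⟨A', hA', ?_, ?_, ?_⟩
  · rintro ⟨⟨x, hx, hux, hwx⟩, -, -⟩
    have h1 : u ∈ activeSet A x := by
      rcases (hact x hx).2 u hux with h | ⟨h, -⟩
      · exact h
      · rw [left_eq_add] at h
        simp [h] at hmw
    have h2 : w ∈ activeSet A x := by
      rcases (hact x hx).2 w hwx with h | ⟨h, -⟩
      · exact h
      · rw [right_eq_add] at h
        simp [h] at hmu
    exact (hact x hx).1 ⟨h1, h2⟩
  · rintro a b ⟨⟨x, hx, ha, hb⟩, hma, hmb⟩
    rcases (hact x hx).2 a ha with h1 | ⟨rfl, z, hz, hs, hzu, hzw⟩ <;>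
      rcases (hact x hx).2 b hb with h2 | ⟨rfl, z', hz', hs', hzu', hzw'⟩
    · exact Or.inl ⟨⟨x, hle hx, h1, h2⟩, hma, hmb⟩
    -- The new pair (a, u + w) has gap m·a - m·w - m·u, and (a, w) was already bad at z', so m·u > 0
    -- makes the gap strictly smaller than the maximum.
    · have := hmax a w ⟨⟨z', hz', hs' h1, hzw'⟩, hma, hmw⟩
      rw [dotProduct_add] at *
      right; omega
    · have := hmax u b ⟨⟨z, hz, hzu, hs h2⟩, hmu, hmb⟩
      rw [dotProduct_add] at *
      right; omega
    · exact absurd hma hmb.not_gt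
  · rintro m' hm' a b ⟨⟨x, hx, ha, hb⟩, hma, hmb⟩
    rcases (hact x hx).2 a ha with h1 | ⟨rfl, z, hz, hs, hzu, hzw⟩ <;>
      rcases (hact x hx).2 b hb with h2 | ⟨rfl, z', hz', hs', hzu', hzw'⟩
    · exact hm' a b ⟨⟨x, hle hx, h1, h2⟩, hma, hmb⟩
    -- Since m' is positive on a, it is negative on neither u nor w, hence not on their sum.
    · have h3 : ¬ m' ⬝ᵥ u < 0 := fun h => hm' a u ⟨⟨z', hz', hs' h1, hzu'⟩, hma, h⟩
      have h4 : ¬ m' ⬝ᵥ w < 0 := fun h => hm' a w ⟨⟨z', hz', hs' h1, hzw'⟩, hma, h⟩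
      rw [dotProduct_add] at hmb
      omega
    · have h3 : ¬ 0 < m' ⬝ᵥ u := fun h => hm' u b ⟨⟨z, hz, hzu, hs h2⟩, h, hmb⟩
      have h4 : ¬ 0 < m' ⬝ᵥ w := fun h => hm' w b ⟨⟨z, hz, hzw, hs h2⟩, h, hmb⟩
      rw [dotProduct_add] at hma
      omega
    · exact absurd hma hmb.not_gt

/-- Induction on the bound N for the gaps, with an inner induction on the number of pairs attaining
the top value: each chop removes one such pair and creates only smaller ones. The last clause lets
the vectors m be treated one after another. -/
theorem IsSmoothSystem.exists_noBadPair (m : Fin n → ℤ) (N : ℕ) :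
    ∀ A : Finset ((Fin n → ℤ) × ℝ), IsSmoothSystem A →
      (∀ a b, IsBadPair A m a b → m ⬝ᵥ a - m ⬝ᵥ b ≤ N) →
      ∃ A', IsSmoothSystem A' ∧ (∀ a b, ¬ IsBadPair A' m a b) ∧
        ∀ m', (∀ a b, ¬ IsBadPair A m' a b) → ∀ a b, ¬ IsBadPair A' m' a b := by
  induction N with
  | zero =>
    -- A bad pair has positive gap, so the bound 0 excludes all of them.
    refine fun A hA h => ⟨A, hA, fun a b hab => ?_, fun _ h => h⟩
    have := h a b hab
    have := hab.2
    push_cast at *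
    omega
  | succ N ih =>
    let T (A : Finset ((Fin n → ℤ) × ℝ)) : Set ((Fin n → ℤ) × (Fin n → ℤ)) :=
      {p | IsBadPair A m p.1 p.2 ∧ m ⬝ᵥ p.1 - m ⬝ᵥ p.2 = N + 1}
    have hT : ∀ A, (T A).Finite := fun A =>
      (finite_setOf_isBadPair A m).subset fun p hp => hp.1
    intro A
    induction hk : (T A).ncard using Nat.strong_induction_on generalizing A with
    | _ k ihk =>
      intro hA h
      rcases (T A).eq_empty_or_nonempty with he | ⟨⟨u, w⟩, hbad, hval⟩
      · refine ih A hA fun a b hab => ?_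
        have h1 := h a b hab
        have h2 : ¬ (m ⬝ᵥ a - m ⬝ᵥ b = N + 1) := fun e =>
          Set.eq_empty_iff_forall_notMem.1 he (a, b) ⟨hab, e⟩
        push_cast at h1
        omega
      · simp only at hbad hval
        push_cast at h
        obtain ⟨A', hA', hnot, hold, hpres⟩ := hA.exists_chop_isBadPair hbad
          fun a b hab => (h a b hab).trans hval.ge
        rw [hval] at hold
        have hss : T A' ⊂ T A := by
          refine ⟨fun p hp => ⟨?_, hp.2⟩, fun hsub => hnot (hsub ⟨hbad, hval⟩ : (u, w) ∈ T A').1⟩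
          rcases hold _ _ hp.1 with h1 | h1
          · exact h1
          · exact absurd hp.2 h1.ne
        obtain ⟨A'', h1, h2, h3⟩ := ihk _ (hk ▸ Set.ncard_lt_ncard hss (hT A)) A' rfl hA'
          (fun a b hab => by
            push_cast
            rcases hold a b hab with h1 | h1
            · exact h a b h1
            · exact h1.le)
        exact ⟨A'', h1, h2, fun m' hm' => h3 m' (hpres m' hm')⟩

/-! ### Common Delzant refinements -/

/-- The cube `[-1, 1]ⁿ`. -/
theorem exists_isSmoothSystem (n : ℕ) : ∃ A : Finset ((Fin n → ℤ) × ℝ), IsSmoothSystem A := by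
  classical
  let A : Finset ((Fin n → ℤ) × ℝ) := (Finset.univ.image fun i : Fin n => (Pi.single i 1, 1)) ∪
    Finset.univ.image fun i : Fin n => (-Pi.single i 1, 1)
  have hmem : ∀ a, a ∈ A ↔ (∃ i, (Pi.single i 1, (1 : ℝ)) = a) ∨
      ∃ i, (-Pi.single i 1, (1 : ℝ)) = a := by
    intro a; simp [A]
  have hin : ∀ (i : Fin n) (x : EucSp n), (inner ℝ (intVec (Pi.single i 1)) x : ℝ) = x i := by
    intro i x
    have : intVec (Pi.single i 1) = EuclideanSpace.single i (1 : ℝ) := by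
      ext j; simp [intVec, Pi.single_apply]
    rw [this, EuclideanSpace.inner_single_left]; simp
  refine ⟨A, ?_, ⟨0, ?_⟩, ?_⟩
  · refine (Metric.isBounded_closedBall (x := (0 : EucSp n)) (r := Real.sqrt n)).subset ?_
    intro x hx
    rw [mem_closedBall_zero_iff, EuclideanSpace.norm_eq]
    refine Real.sqrt_le_sqrt ?_
    have : ∀ i, ‖x i‖ ^ 2 ≤ 1 := by
      intro i
      have h1 := hx _ ((hmem _).2 (Or.inl ⟨i, rfl⟩))
      have h2 := hx _ ((hmem _).2 (Or.inr ⟨i, rfl⟩))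
      simp only [intVec_neg, inner_neg_left, hin] at h1 h2
      rw [Real.norm_eq_abs, sq_abs]
      nlinarith
    simpa using Finset.sum_le_sum fun i (_ : i ∈ Finset.univ) => this i
  · intro a ha
    rcases (hmem a).1 ha with ⟨i, rfl⟩ | ⟨i, rfl⟩ <;> simp
  · intro x hx
    -- At most one of ±eᵢ is tight at x, so a choice of signs of the standard basis contains all
    -- tight normals.
    let s : Fin n → ℤˣ := fun i => if x i = 1 then 1 else -1
    refine ⟨(Pi.basisFun ℤ (Fin n)).unitsSMul s, fun v hv => ?_⟩
    rcases (hmem _).1 hv with ⟨i, hi⟩ | ⟨i, hi⟩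
    · rw [Prod.mk.injEq] at hi
      obtain ⟨rfl, h2⟩ := hi
      rw [hin] at h2
      exact ⟨i, by simp [Module.Basis.unitsSMul_apply, s, h2.symm]⟩
    · rw [Prod.mk.injEq] at hi
      obtain ⟨rfl, h2⟩ := hi
      rw [intVec_neg, inner_neg_left, hin] at h2
      have : x i ≠ 1 := by intro h; rw [h] at h2; norm_num at h2
      exact ⟨i, by simp [Module.Basis.unitsSMul_apply, s, this]⟩

theorem exists_isSmoothSystem_noBadPair (M : Finset (Fin n → ℤ)) :
    ∃ A : Finset ((Fin n → ℤ) × ℝ), IsSmoothSystem A ∧ ∀ m ∈ M, ∀ a b, ¬ IsBadPair A m a b := by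
  classical
  induction M using Finset.induction_on with
  | empty =>
    obtain ⟨A, hA⟩ := exists_isSmoothSystem n
    exact ⟨A, hA, by simp⟩
  | insert m M _ ih =>
    obtain ⟨A, hA, hM⟩ := ih
    obtain ⟨B, hB⟩ := ((finite_setOf_isBadPair A m).image
      fun p => m ⬝ᵥ p.1 - m ⬝ᵥ p.2).bddAbove
    obtain ⟨A', h1, h2, h3⟩ := IsSmoothSystem.exists_noBadPair m B.toNat A hA fun a b hab =>
      (hB ⟨(a, b), hab, rfl⟩).trans (Int.self_le_toNat B)
    refine ⟨A', h1, fun k hk => ?_⟩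
    rcases Finset.mem_insert.1 hk with rfl | hk
    · exact h2
    · exact h3 k (hM k hk)

/-- M collects the inequalities of all normal cones of P. Take the cone containing the sum of the
normals tight at x: without bad pairs, an inequality valid for the sum is valid for every summand,
so that cone contains them all. -/
theorem IsDelzant.exists_finset {P : Set (EucSp n)} (hP : IsDelzant P) :
    ∃ M : Finset (Fin n → ℤ), ∀ A, IsSmoothSystem A → (∀ m ∈ M, ∀ a b, ¬ IsBadPair A m a b) →
      DirRefines (hPoly A) P := by
  classical
  choose! T hT using fun C hC => (hP.unimodular C hC).exists_finset
  refine ⟨hP.isPolytope.finite_normalFan.toFinset.biUnion T, fun A hA hbad β δ => ?_⟩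
  rintro ⟨x, hxβ, hxδ⟩
  set γ : EucSp n := ∑ v ∈ (finite_activeSet A x).toFinset, intVec v with hγ
  have hC : normalConeAt P (faceDir P γ) ∈ normalFan P := ⟨_, ⟨γ, rfl⟩, rfl⟩
  have hγC : γ ∈ normalConeAt P (faceDir P γ) := fun p hp => hp
  obtain ⟨p, hp⟩ := hP.isPolytope.faceDir_nonempty γ
  have hv : ∀ v ∈ intVec '' activeSet A x, p ∈ faceDir P v := by
    rintro _ ⟨v, hv, rfl⟩
    suffices intVec v ∈ normalConeAt P (faceDir P γ) from this hp
    rw [hT _ hC] at hγC ⊢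
    intro m hm
    have h1 := hγC m hm
    have h2 := hbad m (Finset.mem_biUnion.2 ⟨_, by simpa using hC, hm⟩)
    simp only [hγ, inner_sum, inner_intVec] at h1
    rw [inner_intVec]
    by_contra! hneg
    refine absurd h1 (not_le.2 (Finset.sum_neg' (fun a ha => ?_) ⟨v, by simpa using hv, hneg⟩))
    by_contra! hpos
    exact h2 a v ⟨⟨x, hxβ.1, by simpa using ha, hv⟩, by exact_mod_cast hpos, by exact_mod_cast hneg⟩
  exact ⟨p, mem_faceDir_of_mem_hull hp.1 hv (hA.mem_hull_of_mem_faceDir hxβ),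
    mem_faceDir_of_mem_hull hp.1 hv (hA.mem_hull_of_mem_faceDir hxδ)⟩

/-- Finitely many Delzant polytopes have a common Delzant refinement. -/
theorem exists_isDelzant_dirRefines {F : Set (Set (EucSp n))} (hfin : F.Finite)
    (h : ∀ P ∈ F, IsDelzant P) : ∃ R, IsDelzant R ∧ ∀ P ∈ F, DirRefines R P := by
  classical
  choose! M hM using fun P hP => (h P hP).exists_finset
  obtain ⟨A, hA, hbad⟩ := exists_isSmoothSystem_noBadPair (hfin.toFinset.biUnion M)
  exact ⟨hPoly A, hA.isDelzant, fun P hP => hM P hP A hA fun m hm =>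
    hbad m (Finset.mem_biUnion.2 ⟨P, by simpa using hP, hm⟩)⟩

/-! ### Homotopy classes of paths -/

/-- A square with one constant side gives a relation between the homotopy classes of the other
three. -/
theorem Path.Homotopic.Quotient.mk_eq_of_square {X : Type*} [TopologicalSpace X] {x y z : X}
    (f : Path x y) (p : Path x z) (q : Path y z) (H : C(I × I, X)) (h0 : ∀ t, H (0, t) = f t)
    (h1 : ∀ t, H (1, t) = z) (hp : ∀ s, H (s, 0) = p s) (hq : ∀ s, H (s, 1) = q s) :
    mk f = trans (mk p) (symm (mk q)) := by
  obtain rfl : x = H (0, 0) := by rw [h0, f.source]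
  obtain rfl : y = H (0, 1) := by rw [h0, f.target]
  obtain rfl : z = H (1, 0) := (h1 0).symm
  let a : Path ((0, 0) : I × I) (0, 1) := ⟨⟨fun t => (0, t), by fun_prop⟩, rfl, rfl⟩
  let b : Path ((0, 0) : I × I) (1, 0) := ⟨⟨fun t => (t, 0), by fun_prop⟩, rfl, rfl⟩
  let c : Path ((1, 0) : I × I) (1, 1) := ⟨⟨fun t => (1, t), by fun_prop⟩, rfl, rfl⟩
  let d : Path ((0, 1) : I × I) (1, 1) := ⟨⟨fun t => (t, 1), by fun_prop⟩, rfl, rfl⟩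
  -- The point z has become `H (1, 0)`, while the far side ends at `H (1, 1)`; the casts reconcile
  -- the two.
  have hcast : ∀ {u u' v w w' : X} (e : w' = w) (B : Path.Homotopic.Quotient u v)
      (C : Path.Homotopic.Quotient v w) (D : Path.Homotopic.Quotient u' w),
      trans (trans B C) (symm D) =
        trans (trans B (C.cast rfl e)) (symm (D.cast rfl e)) := by
    rintro u u' v w _ rfl B C D
    simp
  have e : H (1, 0) = H (1, 1) := (h1 1).symm
  have hf : f = a.map H.continuous := by ext t; exact (h0 t).symm
  have hb : p = b.map H.continuous := by ext t; exact (hp t).symm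
  have hc : Path.refl _ = (c.map H.continuous).cast rfl e := by ext t; exact (h1 t).symm
  have hd : q = (d.map H.continuous).cast rfl e := by ext t; exact (hq t).symm
  have : ContractibleSpace I := (convex_Icc (0 : ℝ) 1).contractibleSpace ⟨0, by simp⟩
  have hom : a.Homotopic ((b.trans c).trans d.symm) := SimplyConnectedSpace.paths_homotopic _ _
  have hom' := eq.2 (hom.map H)
  rw [hf]
  refine hom'.trans ?_
  rw [Path.map_trans, Path.map_trans, ← Path.map_symm, mk_trans, mk_trans, mk_symm, hcast e,
    ← mk_cast, ← mk_cast, ← hd, ← hc, ← hb, mk_refl, trans_refl]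

theorem Path.Homotopic.Quotient.symm_trans_symm {X : Type*} [TopologicalSpace X] {x y z : X}
    (p : Path.Homotopic.Quotient x z) (q : Path.Homotopic.Quotient y z) :
    symm (trans p (symm q)) = trans q (symm p) := by
  induction p using Path.Homotopic.Quotient.ind with | mk p =>
  induction q using Path.Homotopic.Quotient.ind with | mk q =>
  rw [← mk_symm, ← mk_trans, ← mk_symm, Path.trans_symm, Path.symm_symm, mk_trans, mk_symm]

theorem Path.Homotopic.Quotient.trans_symm_trans_trans_symm {X : Type*} [TopologicalSpace X]
    {x y z w : X} (p : Path.Homotopic.Quotient x w) (q : Path.Homotopic.Quotient y w)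
    (r : Path.Homotopic.Quotient z w) :
    trans (trans p (symm q)) (trans q (symm r)) = trans p (symm r) := by
  rw [trans_assoc, ← trans_assoc (symm q), symm_trans, refl_trans]

/-! ### Straight paths between Delzant polytopes -/

/-- The Minkowski combination `(1 - s) P + s Q`. -/
noncomputable def compactComb (s : I) (P Q : NonemptyCompacts (EucSp n)) :
    NonemptyCompacts (EucSp n) :=
  (P ×ˢ Q).map (fun z => (1 - s : ℝ) • z.1 + (s : ℝ) • z.2) (by fun_prop)

theorem coe_compactComb (s : I) (P Q : NonemptyCompacts (EucSp n)) :
    (compactComb s P Q : Set (EucSp n)) = minkComb (1 - s) s (P : Set (EucSp n)) Q := by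
  ext z
  simp only [compactComb, NonemptyCompacts.coe_map, NonemptyCompacts.coe_prod, Set.mem_image,
    Set.mem_prod, Prod.exists, minkComb, Set.mem_ofPred_eq]
  exact ⟨fun ⟨p, q, ⟨hp, hq⟩, h⟩ => ⟨p, hp, q, hq, h⟩, fun ⟨p, hp, q, hq, h⟩ => ⟨p, q, ⟨hp, hq⟩, h⟩⟩

theorem compactComb_zero (P Q : NonemptyCompacts (EucSp n)) : compactComb 0 P Q = P := by
  ext z
  rw [coe_compactComb]
  obtain ⟨q, hq⟩ := Q.nonempty
  constructor
  · rintro ⟨p, hp, q, -, rfl⟩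
    simpa using hp
  · exact fun hz => ⟨z, hz, q, hq, by simp⟩

theorem compactComb_one (P Q : NonemptyCompacts (EucSp n)) : compactComb 1 P Q = Q := by
  ext z
  rw [coe_compactComb]
  obtain ⟨p, hp⟩ := P.nonempty
  constructor
  · rintro ⟨p, -, q, hq, rfl⟩
    simpa using hq
  · exact fun hz => ⟨p, hp, z, hz, by simp⟩

theorem continuous_compactComb :
    Continuous fun z : I × NonemptyCompacts (EucSp n) × NonemptyCompacts (EucSp n) =>
      compactComb z.1 z.2.1 z.2.2 := by
  refine Continuous.nonemptyCompacts_map' (f := fun z : I × NonemptyCompacts (EucSp n) ×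
    NonemptyCompacts (EucSp n) => z.2.1 ×ˢ z.2.2)
    (g := fun z y => (1 - z.1 : ℝ) • y.1 + (z.1 : ℝ) • y.2) ?_ ?_
  · exact NonemptyCompacts.continuous_prod.comp continuous_snd
  · unfold Function.uncurry
    fun_prop

namespace DelzantSpace

/-- All Minkowski combinations of `P` and `Q` are Delzant. -/
def Joinable (P Q : DelzantSpace n) : Prop :=
  ∀ s : I, IsDelzant (compactComb s P.1 Q.1 : Set (EucSp n))

theorem joinable_of_dirRefines {P Q : DelzantSpace n}
    (h : DirRefines (Q.1 : Set (EucSp n)) (P.1 : Set (EucSp n))) : Joinable P Q := by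
  intro s
  rcases s.2.1.eq_or_lt with e | e
  · obtain rfl : s = 0 := Subtype.ext e.symm
    rw [compactComb_zero]
    exact P.2
  · rw [coe_compactComb]
    exact Q.2.minkComb P.2.isPolytope h (sub_nonneg.2 s.2.2) e

theorem joinable_of_dirRefines' {P Q : DelzantSpace n}
    (h : DirRefines (P.1 : Set (EucSp n)) (Q.1 : Set (EucSp n))) : Joinable P Q := by
  intro s
  rcases s.2.2.eq_or_lt with e | e
  · obtain rfl : s = 1 := Subtype.ext e
    rw [compactComb_one]
    exact Q.2
  · rw [coe_compactComb, minkComb_comm]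
    exact P.2.minkComb Q.2.isPolytope h s.2.1 (sub_pos.2 e)

/-- The straight path from `P` to `Q`. -/
noncomputable def linePath {P Q : DelzantSpace n} (h : Joinable P Q) : Path P Q where
  toFun s := ⟨compactComb s P.1 Q.1, h s⟩
  continuous_toFun := Continuous.subtype_mk
    (continuous_compactComb.comp (f := fun s : I => (s, P.1, Q.1)) (by fun_prop)) _
  source' := Subtype.ext (compactComb_zero _ _)
  target' := Subtype.ext (compactComb_one _ _)

open Path in
-- The square (s, t) ↦ (1 - s) f(t) + s R cones the path to R.
theorem mk_eq_linePath {P Q R : DelzantSpace n} (f : Path P Q) (h : ∀ t, Joinable (f t) R)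
    (hP : Joinable P R) (hQ : Joinable Q R) :
    Homotopic.Quotient.mk f =
      (Homotopic.Quotient.mk (linePath hP)).trans (Homotopic.Quotient.mk (linePath hQ)).symm := by
  refine Homotopic.Quotient.mk_eq_of_square f (linePath hP) (linePath hQ)
    ⟨fun z => ⟨compactComb z.1 (f z.2).1 R.1, h z.2 z.1⟩, Continuous.subtype_mk
      (continuous_compactComb.comp (f := fun z : I × I => (z.1, (f z.2).1, R.1)) (by fun_prop)) _⟩
    (fun t => Subtype.ext (compactComb_zero _ _)) (fun t => Subtype.ext (compactComb_one _ _))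
    (fun s => ?_) (fun s => ?_)
  · simp [linePath]
  · simp [linePath]

open Path in
-- R refines every Minkowski combination of P and Q, so the whole straight path can be coned to R.
theorem mk_linePath_eq {P Q R : DelzantSpace n} (h : Joinable P Q)
    (hP : DirRefines (R.1 : Set (EucSp n)) (P.1 : Set (EucSp n)))
    (hQ : DirRefines (R.1 : Set (EucSp n)) (Q.1 : Set (EucSp n))) :
    Homotopic.Quotient.mk (linePath h) = (Homotopic.Quotient.mk (linePath (joinable_of_dirRefines hP))).trans
      (Homotopic.Quotient.mk (linePath (joinable_of_dirRefines hQ))).symm := by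
  refine mk_eq_linePath _ (fun s => joinable_of_dirRefines ?_) _ _
  change DirRefines _ (compactComb s P.1 Q.1 : Set (EucSp n))
  rw [coe_compactComb]
  exact hP.minkComb hQ (sub_nonneg.2 s.2.2) s.2.1

open Path in
-- Coning first to C and then to R produces the straight path from C to R together with its inverse,
-- which cancel.
theorem mk_subpath_eq {P Q R C : DelzantSpace n} (γ : Path P Q) {a b : I} (hab : a ≤ b)
    (hC : ∀ t ∈ Set.Icc a b, FanRefines (γ t).fan C.fan)
    (hRC : DirRefines (R.1 : Set (EucSp n)) (C.1 : Set (EucSp n)))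
    (ha : DirRefines (R.1 : Set (EucSp n)) ((γ a).1 : Set (EucSp n)))
    (hb : DirRefines (R.1 : Set (EucSp n)) ((γ b).1 : Set (EucSp n))) :
    Homotopic.Quotient.mk (γ.subpath a b) = (Homotopic.Quotient.mk (linePath (joinable_of_dirRefines ha))).trans
      (Homotopic.Quotient.mk (linePath (joinable_of_dirRefines hb))).symm := by
  have hJ : ∀ t ∈ Set.Icc a b, Joinable (γ t) C := fun t ht =>
    joinable_of_dirRefines' ((hC t ht).dirRefines C.2.isPolytope)
  have hJ' : ∀ s, Joinable (γ.subpath a b s) C := by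
    intro s
    have : γ.subpath a b s ∈ Set.range (γ.subpath a b) := ⟨s, rfl⟩
    rw [Path.range_subpath_of_le _ _ _ hab] at this
    obtain ⟨t, ht, e⟩ := this
    exact e ▸ hJ t ht
  rw [mk_eq_linePath (γ.subpath a b) hJ' (hJ a (Set.left_mem_Icc.2 hab))
    (hJ b (Set.right_mem_Icc.2 hab)), mk_linePath_eq _ ha hRC, mk_linePath_eq _ hb hRC,
    Homotopic.Quotient.symm_trans_symm, Homotopic.Quotient.trans_symm_trans_trans_symm]

end DelzantSpace

/-! ### Locally refining loops and finite complexity -/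

open Path in
theorem IsLocallyRefining.homotopic_refl {P : DelzantSpace n} {γ : Path P P}
    (hγ : IsLocallyRefining γ) : Path.Homotopic γ (Path.refl P) := by
  choose ε hε href using hγ
  obtain ⟨t, ht0, hmono, ⟨N, hN⟩, hcov⟩ := exists_monotone_Icc_subset_open_cover_unitInterval
    (c := fun s : I => Metric.ball s (ε s)) (fun s => Metric.isOpen_ball)
    (fun s _ => Set.mem_iUnion.2 ⟨s, Metric.mem_ball_self (hε s)⟩)
  choose τ hτ using hcov
  let F : Set (Set (EucSp n)) := ((fun k => ((γ (t k)).1 : Set (EucSp n))) '' Set.Iic N) ∪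
    ((fun k => ((γ (τ k)).1 : Set (EucSp n))) '' Set.Iic N)
  obtain ⟨R, hR, hRF⟩ := exists_isDelzant_dirRefines (F := F)
    (((Set.finite_Iic N).image _).union ((Set.finite_Iic N).image _)) (by
      rintro _ (⟨k, -, rfl⟩ | ⟨k, -, rfl⟩)
      · exact (γ (t k)).2
      · exact (γ (τ k)).2)
  let R' : DelzantSpace n := ⟨⟨⟨R, hR.isPolytope.isCompact⟩, hR.isPolytope.nonempty⟩, hR⟩
  have hRt : ∀ k ≤ N, DirRefines (R'.1 : Set (EucSp n)) ((γ (t k)).1 : Set (EucSp n)) :=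
    fun k hk => hRF _ (Or.inl ⟨k, hk, rfl⟩)
  have hRτ : ∀ k ≤ N, DirRefines (R'.1 : Set (EucSp n)) ((γ (τ k)).1 : Set (EucSp n)) :=
    fun k hk => hRF _ (Or.inr ⟨k, hk, rfl⟩)
  have step : ∀ k (hk : k ≤ N), Homotopic.Quotient.mk (γ.subpath (t 0) (t k)) =
      (Homotopic.Quotient.mk (DelzantSpace.linePath
        (DelzantSpace.joinable_of_dirRefines (hRt 0 (Nat.zero_le N))))).trans
      (Homotopic.Quotient.mk (DelzantSpace.linePath
        (DelzantSpace.joinable_of_dirRefines (hRt k hk)))).symm := by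
    intro k
    induction k with
    | zero =>
      intro _
      rw [Path.subpath_self, Homotopic.Quotient.trans_symm, Homotopic.Quotient.mk_refl]
    | succ k ih =>
      intro hk
      have hk' : k ≤ N := (Nat.le_succ k).trans hk
      rw [← Homotopic.Quotient.eq.2 ⟨Path.Homotopy.subpathTransSubpath γ (t 0) (t k) (t (k + 1))⟩,
        Homotopic.Quotient.mk_trans, ih hk',
        DelzantSpace.mk_subpath_eq γ (hmono (Nat.le_succ k)) (C := γ (τ k)) (fun s hs => ?_)
          (hRτ k hk') (hRt k hk') (hRt (k + 1) hk)]
      · exact Homotopic.Quotient.trans_symm_trans_trans_symm _ _ _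
      · have := hτ k hs
        rw [Metric.mem_ball, Subtype.dist_eq, Real.dist_eq] at this
        exact href _ _ this.le
  -- The equalities `t 0 = 0`, `t N = 1` and γ(0) = γ(1) = P become substitutable only after the
  -- endpoints are generalized.
  have aux : ∀ (a b : I) (h0 : a = 0) (h1 : b = 1)
      (ha : DirRefines (R'.1 : Set (EucSp n)) ((γ a).1 : Set (EucSp n)))
      (hb : DirRefines (R'.1 : Set (EucSp n)) ((γ b).1 : Set (EucSp n))),
      Homotopic.Quotient.mk (γ.subpath a b) =
        (Homotopic.Quotient.mk (DelzantSpace.linePath (DelzantSpace.joinable_of_dirRefines ha))).trans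
        (Homotopic.Quotient.mk (DelzantSpace.linePath (DelzantSpace.joinable_of_dirRefines hb))).symm →
      Path.Homotopic γ (Path.refl P) := by
    rintro a b rfl rfl ha hb h
    rw [Path.subpath_zero_one] at h
    have aux' : ∀ (x y : DelzantSpace n) (hx : x = P) (hy : y = P)
        (ha : DirRefines (R'.1 : Set (EucSp n)) (x.1 : Set (EucSp n)))
        (hb : DirRefines (R'.1 : Set (EucSp n)) (y.1 : Set (EucSp n))),
        Homotopic.Quotient.mk (γ.cast hx hy) =
          (Homotopic.Quotient.mk (DelzantSpace.linePath (DelzantSpace.joinable_of_dirRefines ha))).trans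
          (Homotopic.Quotient.mk (DelzantSpace.linePath (DelzantSpace.joinable_of_dirRefines hb))).symm →
        Path.Homotopic γ (Path.refl P) := by
      rintro x y rfl rfl ha hb h
      rw [Homotopic.Quotient.trans_symm, ← Homotopic.Quotient.mk_refl] at h
      exact Homotopic.Quotient.eq.1 h
    exact aux' _ _ γ.source γ.target ha hb h
  exact aux _ _ ht0 (hN N le_rfl) (hRt 0 (Nat.zero_le N)) (hRt N le_rfl) (step N le_rfl)

/-- A fan S that does not refine the fan at t₀ cannot recur arbitrarily near t₀, since refinement
passes to the limit. Finitely many fans give a common neighbourhood. -/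
theorem HasFiniteComplexity.isLocallyRefining {P Q : DelzantSpace n} {γ : Path P Q}
    (hγ : HasFiniteComplexity γ) : IsLocallyRefining γ := by
  intro t₀
  have key : ∀ S ∈ Set.range fun t : I => (γ t).fan, ∀ᶠ t in nhds t₀,
      (γ t).fan = S → FanRefines S (γ t₀).fan := by
    rintro _ ⟨t₁, rfl⟩
    by_contra hcon
    have hfreq := Filter.not_eventually.1 hcon
    have hnot : ¬ FanRefines (γ t₁).fan (γ t₀).fan := by
      obtain ⟨t, ht⟩ := hfreq.exists
      exact fun h => ht fun _ => h
    refine hnot (DirRefines.fanRefines (γ t₁).2.isPolytope ?_)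
    refine dirRefines_of_forall_near fun η hη => ?_
    have hc : Filter.Tendsto (fun t => (γ t).1) (nhds t₀) (nhds (γ t₀).1) :=
      (continuous_subtype_val.comp γ.continuous).tendsto t₀
    obtain ⟨t, ht, hd⟩ := (hfreq.and_eventually (hc.eventually (Metric.ball_mem_nhds _ hη))).exists
    have hfan : (γ t).fan = (γ t₁).fan := (Classical.not_imp.1 ht).1
    refine ⟨(γ t).1, hd, FanRefines.dirRefines (γ t).2.isPolytope ?_⟩
    change FanRefines (γ t₁).fan (γ t).fan
    rw [hfan]
    exact fanRefines_refl _
  have hall := (Filter.eventually_all_finite hγ).2 key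
  obtain ⟨ε, hε, h⟩ := Metric.eventually_nhds_iff.1 hall
  refine ⟨ε / 2, half_pos hε, fun t ht => h ?_ _ ⟨t, rfl⟩ rfl⟩
  rw [Subtype.dist_eq, Real.dist_eq]
  linarith

theorem mainTheorem8 (n : ℕ) (P : DelzantSpace n) (γ : Path P P) :
    (IsLocallyRefining γ → Path.Homotopic γ (Path.refl P)) ∧
      (HasFiniteComplexity γ → IsLocallyRefining γ) :=
  ⟨IsLocallyRefining.homotopic_refl, HasFiniteComplexity.isLocallyRefining⟩
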